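/- **Setting.** Let $(X_t)_{t\ge 1}$ be a strictly stationary sequence of jointly measurable random curves $X_t=(X_t(s))_{s\in[0,1]}$. For each sample size $T$ let $p=p(T)$, let $0\le s_1<\dots<s_p\le 1$ be sampling points (depending on $T$), and observe $y_t=(X_t(s_1)+u_{t1},\dots,X_t(s_p)+u_{tp})^\top$, $1\le t\le T$ (the errors $u_{ti}$ may depend on $T$). Put $Y=(y_1,\dots,y_T)$ and let $\hat\gamma_1\ge\hat\gamma_2\ge\dots$ be the eigenvalues of the $T\times T$ matrix $T^{-1}Y^\top Y$, with $\hat\gamma_i=0$ for $i>T$. Let $\Gamma^X(s,s')=\mathrm{Cov}(X_1(s),X_1(s'))$, let $\lambda_1\ge\lambda_2\ge\dots\ge 0$ be the eigenvalues (with multiplicity) of the integral operator on $L^2([0,1])$ with kernel $\Gamma^X$, and let $(\varphi_\ell)$ be an orthonormal sequence of corresponding eigenfunctions, with the operator vanishing on its orthogonal complement. Let $L\ge 1$ be fixed. **Assumptions.** 1. (Noise) For each $T$ the vectors $u_t=(u_{t1},\dots,u_{tp})^\top$, $1\le t\le T$, are i.i.d., centred Gaussian, independent of $(X_t)$, with $\mathrm{Cov}(u_{ti},u_{tj})=\gamma^u(i-j)$,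 where $\gamma^u$ does not depend on $T$ and $\sum_{h\in\mathbb Z}|\gamma^u(h)|<\infty$. 2. (Signal) $EX_t(s)=0$ for all $t,s$. As random elements of $L^2([0,1])$, the $X_t$ are $L^4$-$m$-approximable: $X_t=g(\delta_t,\delta_{t-1},\dots)$ a.s. for i.i.d. $(\delta_t)_{t\in\mathbb Z}$ and measurable $g$, and $\sum_{m\ge1}\big(E\|X_t-g(\delta_t,\dots,\delta_{t-m},\delta'_{t-m-1},\delta'_{t-m-2},\dots)\|^4\big)^{1/4}<\infty$, where $(\delta'_t)$ is an independent copy of $(\delta_t)$. Moreover $\sup_{s}EX_1(s)^4<\infty$, $\Gamma^X$ is continuous, $E\sup_s X_1(s)^2<\infty$, and there is an $L$-dimensional subspace of $L^2([0,1])$ that almost surely contains each $X_t$. 3. (Eigenfunctions) $\max_{1\le k,\ell\le L}\big|p^{-1}\sum_{i=1}^p\varphi_k(s_i)\varphi_\ell(s_i)\big|=O(1)$ as $T\to\infty$. 4. $p(T)\to\infty$ at a subexponential rate: $p(T)=o(e^{cT})$ for every $c>0$. 5. The sampling points are equidistant on $[0,1]$: $s_{i+1}-s_i=h_T$ for all $i<p$,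 with $s_1\le h_T$ and $1-s_p\le h_T$. 6. $\sup_{s}E|X_1(s+h)-X_1(s)|^2=O(h)$ as $h\to0$ (over $s,s+h\in[0,1]$). **Conclusion.** As $T\to\infty$, $$\sup_{i\ge1}\Big|\lambda_i-\frac{\hat\gamma_i}{p}\Big|=O_P\Big(\frac1{\sqrt p}+\frac1{\sqrt T}\Big).$$ If moreover $\lambda_L>0$, then $p/\hat\gamma_L\to 1/\lambda_L$ in probability, and in particular $p/\hat\gamma_L=O_P(1)$. -/

import Mathlib

open MeasureTheory ProbabilityTheory Filter Topology
open scoped unitInterval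

namespace NoisyFDA

/-- `Z n = O_P(r n)` as `n → ∞`. -/
def IsBigOP {Ω : Type*} [MeasurableSpace Ω] (P : Measure Ω) (Z : ℕ → Ω → ℝ) (r : ℕ → ℝ) : Prop :=
  ∀ ε : ℝ, 0 < ε → ∃ M : ℝ, ∀ᶠ n in atTop, P {ω | M * r n < |Z n ω|} ≤ ENNReal.ofReal ε

/-- `L^q`-`m`-approximability of a sequence `(Z_t)` with values in a normed space `H`:
`Z_t = g(δ_t, δ_{t-1}, …)` almost surely, with i.i.d. innovations `(δ_t)` in `S` and measurable `g`,
and the `L^q` distances between `Z_0` and its coupled versions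
`g(δ_0, …, δ_{-m}, δ'_{-m-1}, δ'_{-m-2}, …)` are summable over `m ≥ 1`.
The independent copy `(δ'_t)` is realised as the second coordinate of `Ω × Ω`. -/
def IsLpMApproximable {Ω H : Type*} [MeasurableSpace Ω] [NormedAddCommGroup H]
    (S : Type*) [MeasurableSpace S] (P : Measure Ω) (q : ENNReal) (Z : ℕ → Ω → H) : Prop :=
  ∃ (δ : ℤ → Ω → S) (g : (ℕ → S) → H),
    (∀ t, Measurable (δ t)) ∧ iIndepFun δ P ∧ (∀ t, IdentDistrib (δ t) (δ 0) P P) ∧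
    StronglyMeasurable g ∧
    (∀ t : ℕ, ∀ᵐ ω ∂P, Z t ω = g (fun k => δ ((t : ℤ) - k) ω)) ∧
    ∑' m : ℕ, eLpNorm
      (fun w : Ω × Ω => g (fun k => δ (-(k : ℤ)) w.1) -
        g (fun k => if k ≤ m + 1 then δ (-(k : ℤ)) w.1 else δ (-(k : ℤ)) w.2))
      q (P.prod P) < ⊤

/-- The noise assumption. For every sample size `T`, `u T t i` is the error at time `t` in the
`i`-th sampling point (indices start at `0`). The vectors `u T t` are i.i.d., centred Gaussian,
independent of the signals, with autocovariance function `γ` summable over `ℤ`. -/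
structure NoiseAssumption {Ω : Type*} [MeasurableSpace Ω] (P : Measure Ω) (X : ℕ → I → Ω → ℝ)
    (p : ℕ → ℕ) (u : (T : ℕ) → Fin T → Fin (p T) → Ω → ℝ) (γ : ℤ → ℝ) : Prop where
  iIndep : ∀ T, iIndepFun (fun t ω i => u T t i ω) P
  identDistrib : ∀ T t t', IdentDistrib (fun ω i => u T t i ω) (fun ω i => u T t' i ω) P P
  indep_signal : ∀ T, IndepFun (fun ω (q : Fin T × Fin (p T)) => u T q.1 q.2 ω)
    (fun ω (q : ℕ × I) => X q.1 q.2 ω) P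
  gaussian : ∀ T t, HasGaussianLaw (fun ω i => u T t i ω) P
  mean_zero : ∀ T t i, ∫ ω, u T t i ω ∂P = 0
  cov_eq : ∀ T t i j, cov[u T t i, u T t j; P] = γ ((i : ℤ) - (j : ℤ))
  summable : Summable fun h : ℤ => |γ h|

/-- The signal assumption; `X t` is the `(t+1)`-st curve. The process is strictly stationary (as a
family of real random variables indexed by time and `s ∈ [0,1]`) and jointly measurable. -/
structure SignalAssumption {Ω : Type*} [MeasurableSpace Ω] (S : Type*) [MeasurableSpace S]
    (P : Measure Ω) (X : ℕ → I → Ω → ℝ) (L : ℕ) : Prop where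
  measurable : ∀ t, Measurable fun q : I × Ω => X t q.1 q.2
  stationary : IdentDistrib (fun ω (q : ℕ × I) => X (q.1 + 1) q.2 ω)
    (fun ω (q : ℕ × I) => X q.1 q.2 ω) P P
  mean_zero : ∀ t s, ∫ ω, X t s ω ∂P = 0
  /-- The curves, as elements of `L²([0,1])`, are `L⁴`-`m`-approximable. -/
  approximable : ∃ Z : ℕ → Ω → Lp ℝ 2 (volume : Measure I),
    (∀ t, ∀ᵐ ω ∂P, (fun s => X t s ω) =ᵐ[volume] (Z t ω : I → ℝ)) ∧ IsLpMApproximable S P 4 Z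
  fourth_moment : ∃ C : ℝ, ∀ s, MemLp (X 0 s) 4 P ∧ ∫ ω, X 0 s ω ^ 4 ∂P ≤ C
  continuous_cov : Continuous fun q : I × I => cov[X 0 q.1, X 0 q.2; P]
  sup_moment : ∫⁻ ω, ⨆ s : I, ENNReal.ofReal (X 0 s ω ^ 2) ∂P < ⊤
  finite_dim : ∃ V : Submodule ℝ (Lp ℝ 2 (volume : Measure I)), Module.finrank ℝ V = L ∧
    ∀ t, ∀ᵐ ω ∂P, ∃ v ∈ V, (fun s => X t s ω) =ᵐ[volume] (v : I → ℝ)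

/-- `lam 0 ≥ lam 1 ≥ … ≥ 0` is the full list of eigenvalues, with multiplicity, of the integral
operator on `L²([0,1])` with kernel `K`, and `φ` is an orthonormal sequence of eigenfunctions;
the operator vanishes on the orthogonal complement of `φ`. -/
structure IsEigensystem (K : I → I → ℝ) (lam : ℕ → ℝ) (φ : ℕ → I → ℝ) : Prop where
  antitone : Antitone lam
  nonneg : ∀ i, 0 ≤ lam i
  memLp : ∀ i, MemLp (φ i) 2 volume
  orthonormal : ∀ i j, ∫ s, φ i s * φ j s = if i = j then 1 else 0
  eigen : ∀ i r, ∫ s, K r s * φ i s = lam i * φ i r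
  complete : ∀ f : I → ℝ, MemLp f 2 volume → (∀ i, ∫ s, φ i s * f s = 0) →
    ∀ r, ∫ s, K r s * f s = 0

/-- Boundedness, as `T → ∞`, of the discretised inner products of the first `L` eigenfunctions. -/
def EigenfunctionAssumption (p : ℕ → ℕ) (s : (T : ℕ) → Fin (p T) → I) (φ : ℕ → I → ℝ) (L : ℕ) :
    Prop :=
  ∃ C : ℝ, ∀ᶠ T in atTop, ∀ k < L, ∀ l < L,
    |(p T : ℝ)⁻¹ * ∑ i, φ k (s T i) * φ l (s T i)| ≤ C

/-- `p(T) → ∞` at a subexponential rate. -/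
def DivergesSubexponentially (p : ℕ → ℕ) : Prop :=
  Tendsto p atTop atTop ∧
    ∀ c : ℝ, 0 < c → (fun T => (p T : ℝ)) =o[atTop] fun T => Real.exp (c * T)

/-- `n` equidistant points of `[0,1]` with spacing `h`, such that the distances from the extreme
points to the ends of `[0,1]` are at most `h`. -/
def IsEquidistant {n : ℕ} (s : Fin n → I) : Prop :=
  ∃ a h : ℝ, 0 < h ∧ a ≤ h ∧ 1 ≤ a + n * h ∧ ∀ i : Fin n, (s i : ℝ) = a + (i : ℕ) * h

/-- `sup_s E|X(s+h) - X(s)|² = O(h)` as `h → 0`. -/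
def IncrementCondition {Ω : Type*} [MeasurableSpace Ω] (P : Measure Ω) (X : I → Ω → ℝ) : Prop :=
  ∃ C η : ℝ, 0 < η ∧ ∀ s s' : I, |(s' : ℝ) - s| ≤ η →
    ∫ ω, (X s' ω - X s ω) ^ 2 ∂P ≤ C * |(s' : ℝ) - s|

/-- The `p × T` data matrix `Y = (y_1, …, y_T)`, `y_t = X_t(s) + u_t`. -/
def dataMatrix {Ω : Type*} (X : ℕ → I → Ω → ℝ) (p : ℕ → ℕ) (s : (T : ℕ) → Fin (p T) → I)
    (u : (T : ℕ) → Fin T → Fin (p T) → Ω → ℝ) (T : ℕ) (ω : Ω) : Matrix (Fin (p T)) (Fin T) ℝ :=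
  Matrix.of fun i t => X t (s T i) ω + u T t i ω

/-- The matrix `T⁻¹ Yᵀ Y`. -/
noncomputable def gram {n T : ℕ} (Y : Matrix (Fin n) (Fin T) ℝ) : Matrix (Fin T) (Fin T) ℝ :=
  (T : ℝ)⁻¹ • (Y.transpose * Y)

lemma gram_isHermitian {n T : ℕ} (Y : Matrix (Fin n) (Fin T) ℝ) : (gram Y).IsHermitian := by
  simp [gram, Matrix.IsHermitian]

/-- The eigenvalues of `T⁻¹ Yᵀ Y` in decreasing order with multiplicity (the first one has
index `0`), followed by zeros. -/
noncomputable def gammaHat {n T : ℕ} (Y : Matrix (Fin n) (Fin T) ℝ) (i : ℕ) : ℝ :=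
  if hi : i < Fintype.card (Fin T) then (gram_isHermitian Y).eigenvalues₀ ⟨i, hi⟩ else 0

end NoisyFDA

/-! The map sending a sample vector to the step function `stepL2` on a uniform partition of [0,1]
multiplies inner products by 1/p. Hence the eigenvalues of `gram Y`, divided by p, are those of the
empirical covariance form f ↦ T⁻¹ ∑ ⟨stepL2 y_t, f⟩² on L²([0,1]), up to zeros, while the λ_i are
those of the form f ↦ E⟨X, f⟩². A Weyl inequality, proved by min-max across two Hilbert spaces
(`le_of_adjoint_pair`, `abs_sub_eigenvalueSeq_le`), bounds every |λ_i - γ̂_i/p| at once by any ε for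
which the two forms differ by at most ε‖f‖². The supremum over i therefore costs nothing.

`abs_sum_inner_sq_sub_le` splits this ε into four errors. (1) Empirical against true covariance of
the curves. The curves live in an L-dimensional space, so finitely many coordinate products matter.
Their autocovariances are summable by coupling (`exists_summable_abs_integral_le`), which gives
T^(-1/2). (2) Discretisation. The increment condition makes the mean squared distance between a
curve and its step function O(1/p); the term linear in this distance gives p^(-1/2). (3)
Signal-noise cross terms. Independence and absence of serial correlation in the noise give T^(-1/2)
in Frobenius norm (`integral_crossMatrix_le`). (4) Pure noise. The Frobenius norm of the scaled
sample covariance has mean square O(1/T + 1/p): 1/T from sampling, 1/p because summable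
autocovariances give a p × p Toeplitz matrix only O(p) squared Frobenius norm
(`NoiseAssumption.integral_noiseMatrix_le`).

Markov's inequality turns these moment bounds into O_P statements. The claim on reciprocals follows
by continuity of x ↦ 1/x at λ_L > 0. -/

namespace NoisyFDA

open scoped RealInnerProductSpace

/-! ### Min-max comparison of eigenvalues across two Hilbert spaces. -/

section Eigenvalues

variable {E H : Type*} [NormedAddCommGroup E] [InnerProductSpace ℝ E]
  [NormedAddCommGroup H] [InnerProductSpace ℝ H]

/-- If the quadratic form `‖A⋆ f‖²` is at least `μ ‖f‖²` on a space of dimension `n + 1`, and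
`‖A c‖²` is at most `ν ‖c‖²` on the orthogonal complement of `n` vectors, then `μ ≤ ν`. -/
lemma le_of_adjoint_pair {n : ℕ} (A : E →ₗ[ℝ] H) (B : H →ₗ[ℝ] E)
    (hAB : ∀ c f, ⟪A c, f⟫ = ⟪c, B f⟫) (w : Fin (n + 1) → H) (hw : LinearIndependent ℝ w)
    (v : Fin n → E) {μ ν : ℝ} (hν : 0 ≤ ν)
    (hμ : ∀ b : Fin (n + 1) → ℝ, μ * ‖∑ k, b k • w k‖ ^ 2 ≤ ‖B (∑ k, b k • w k)‖ ^ 2)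
    (hA : ∀ c, (∀ j, ⟪v j, c⟫ = 0) → ‖A c‖ ^ 2 ≤ ν * ‖c‖ ^ 2) : μ ≤ ν := by
  by_contra! hlt
  -- Orthogonality of `B f` to the `v j` is n linear conditions on n + 1 coefficients, so a nonzero
  -- f in the span of w satisfies them all.
  let F : (Fin (n + 1) → ℝ) →ₗ[ℝ] (Fin n → ℝ) :=
    LinearMap.pi fun j => (innerₛₗ ℝ (v j)) ∘ₗ B ∘ₗ Fintype.linearCombination ℝ w
  obtain ⟨b, hb, hb0⟩ := (Submodule.ne_bot_iff _).1
    (LinearMap.ker_ne_bot_of_finrank_lt (f := F) (by simp))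
  set f : H := ∑ k, b k • w k with hf
  have hf0 : f ≠ 0 := fun h => hb0 (funext (Fintype.linearIndependent_iff.1 hw b h))
  have hperp : ∀ j, ⟪v j, B f⟫ = 0 := fun j => by
    have := congrFun (LinearMap.mem_ker.1 hb) j
    simpa [F, Fintype.linearCombination_apply, hf] using this
  have h1 := hμ b
  have h2 := hA (B f) hperp
  rw [← hf] at h1
  have hfp : 0 < ‖f‖ := norm_pos_iff.2 hf0
  have hBf : 0 < ‖B f‖ ^ 2 := lt_of_lt_of_le (by have := hν.trans_lt hlt; positivity) h1
  -- Since ‖B f‖² = ⟨A (B f), f⟩, Cauchy–Schwarz and `hA` at c = `B f` give ‖B f‖² ≤ ν ‖f‖² once the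
  -- positive factor ‖B f‖² is cancelled.
  have h3 : ‖B f‖ ^ 2 ≤ ‖A (B f)‖ * ‖f‖ := by
    rw [← real_inner_self_eq_norm_sq, ← hAB]
    exact real_inner_le_norm _ _
  have h4 : ‖B f‖ ^ 2 * ‖B f‖ ^ 2 ≤ (ν * ‖f‖ ^ 2) * ‖B f‖ ^ 2 := by
    calc ‖B f‖ ^ 2 * ‖B f‖ ^ 2 ≤ (‖A (B f)‖ * ‖f‖) * (‖A (B f)‖ * ‖f‖) := by gcongr
      _ = ‖A (B f)‖ ^ 2 * ‖f‖ ^ 2 := by ring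
      _ ≤ (ν * ‖B f‖ ^ 2) * ‖f‖ ^ 2 := by gcongr
      _ = _ := by ring
  have h5 := le_of_mul_le_mul_right h4 hBf
  have h6 : ν * ‖f‖ ^ 2 < μ * ‖f‖ ^ 2 := by gcongr
  linarith

/-- The eigenvalues in decreasing order, followed by zeros. -/
noncomputable def eigenvalueSeq {T : ℕ} {G : Matrix (Fin T) (Fin T) ℝ} (hG : G.IsHermitian)
    (i : ℕ) : ℝ :=
  if hi : i < Fintype.card (Fin T) then hG.eigenvalues₀ ⟨i, hi⟩ else 0

/-- Comparison of the eigenvalues of a Gram matrix with those of a quadratic form `q`. -/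
lemma abs_sub_eigenvalueSeq_le {T : ℕ} (a : Fin T → H) {G : Matrix (Fin T) (Fin T) ℝ}
    (hG : G.IsHermitian) (hGa : ∀ t t', G t t' = ⟪a t, a t'⟫) {lam : ℕ → ℝ}
    (hlam : ∀ i, 0 ≤ lam i) {φ : ℕ → H} (hφ : Orthonormal ℝ φ) {q : H → ℝ}
    (h1 : ∀ i, ∀ b : Fin (i + 1) → ℝ,
      lam i * ‖∑ k, b k • φ k‖ ^ 2 ≤ q (∑ k, b k • φ k))
    (h2 : ∀ i f, (∀ j < i, ⟪φ j, f⟫ = 0) → q f ≤ lam i * ‖f‖ ^ 2) {ε : ℝ}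
    (hε : ∀ f, |∑ t, ⟪a t, f⟫ ^ 2 - q f| ≤ ε * ‖f‖ ^ 2) (i : ℕ) :
    |lam i - eigenvalueSeq hG i| ≤ ε := by
  have hε0 : 0 ≤ ε := by
    have := (abs_nonneg _).trans (hε (φ 0))
    simpa [hφ.1 0] using this
  -- The sorted list `eigenvalues₀` and the eigenvector basis have different index types; reindexing
  -- makes `v k` an eigenvector for the k-th largest eigenvalue.
  let e : Fin (Fintype.card (Fin T)) ≃ Fin T := Fintype.equivOfCardEq (Fintype.card_fin _)
  let v := hG.eigenvectorBasis.reindex e.symm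
  let ν := hG.eigenvalues₀
  -- A synthesises from the vectors a_t and B is its adjoint: B ∘ A is the matrix G, and ‖B f‖² is
  -- the quadratic form ∑ ⟨a_t, f⟩².
  let A : EuclideanSpace ℝ (Fin T) →ₗ[ℝ] H :=
    Fintype.linearCombination ℝ a ∘ₗ (WithLp.linearEquiv 2 ℝ (Fin T → ℝ)).toLinearMap
  let B : H →ₗ[ℝ] EuclideanSpace ℝ (Fin T) :=
    (WithLp.linearEquiv 2 ℝ (Fin T → ℝ)).symm.toLinearMap ∘ₗ
      LinearMap.pi fun t => innerₛₗ ℝ (a t)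
  have hA : ∀ c, A c = ∑ t, c t • a t := fun c => by
    simp [A, Fintype.linearCombination_apply]
  have hB : ∀ f t, B f t = ⟪a t, f⟫ := fun f t => by simp [B]
  have hBn : ∀ f, ‖B f‖ ^ 2 = ∑ t, ⟪a t, f⟫ ^ 2 := fun f => by
    simp [EuclideanSpace.norm_sq_eq, hB]
  have hAB : ∀ c f, ⟪A c, f⟫ = ⟪c, B f⟫ := fun c f => by
    simp [hA, sum_inner, inner_smul_left, PiLp.inner_apply, hB, mul_comm]
  have hv : ∀ k, G.mulVec (v k) = ν k • ⇑(v k) := fun k => by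
    have := hG.mulVec_eigenvectorBasis (e k)
    simpa [v, ν, Matrix.IsHermitian.eigenvalues, e] using this
  have hBA : ∀ c t, B (A c) t = G.mulVec c t := fun c t => by
    simp [hB, hA, Matrix.mulVec, dotProduct, hGa, mul_comm]
  have hBAv : ∀ k, B (A (v k)) = ν k • v k := fun k => by
    ext t
    rw [hBA, hv]
    simp
  have hnorm : ∀ c, ‖A c‖ ^ 2 = ∑ k, ν k * ⟪v k, c⟫ ^ 2 := fun c => by
    rw [← real_inner_self_eq_norm_sq]
    conv_lhs => rw [← v.sum_repr' c]
    simp only [map_sum, map_smul, sum_inner, inner_sum, inner_smul_left, inner_smul_right,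
      hAB, hBAv, v.inner_eq_ite]
    simp
    exact Finset.sum_congr rfl fun k _ => by ring
  have hnc : ∀ c, ‖c‖ ^ 2 = ∑ k, ⟪v k, c⟫ ^ 2 := fun c => by
    rw [← v.sum_sq_norm_inner_right c]; simp
  have hν0 : ∀ k, 0 ≤ ν k := fun k => by
    have := hnorm (v k)
    simp [v.inner_eq_ite] at this
    rw [← this]; positivity
  have hS0 : 0 ≤ eigenvalueSeq hG i := by
    unfold eigenvalueSeq; split_ifs with hi
    exacts [hν0 _, le_rfl]
  have hanti : Antitone ν := hG.eigenvalues₀_antitone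
  rw [abs_le]
  constructor
  · unfold eigenvalueSeq
    split_ifs with hi
    -- Upper bound on the Gram eigenvalue: A and B exchange roles, the test space being spanned by
    -- the top i + 1 eigenvectors of G and the constraints given by the first i of the φ's.
    · have := le_of_adjoint_pair (n := i) B A (fun c f => by
        rw [real_inner_comm, ← hAB, real_inner_comm]) (fun k => v ⟨k, by omega⟩)
        (v.orthonormal.linearIndependent.comp _ fun x y h => by simpa [Fin.ext_iff] using h)
        (fun j => φ j) (μ := ν ⟨i, hi⟩) (ν := lam i + ε) (add_nonneg (hlam i) hε0) ?_ ?_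
      · change _ ≤ lam i - ν ⟨i, hi⟩
        linarith
      · intro b
        rw [hnorm, hnc, Finset.mul_sum]
        refine Finset.sum_le_sum fun k _ => ?_
        by_cases hk : k ≤ ⟨i, hi⟩
        · exact mul_le_mul_of_nonneg_right (hanti hk) (sq_nonneg _)
        · have : ⟪v k, ∑ l : Fin (i + 1), b l • v ⟨l, by omega⟩⟫ = 0 := by
            rw [inner_sum]
            refine Finset.sum_eq_zero fun l _ => ?_
            rw [inner_smul_right, v.inner_eq_ite, if_neg, mul_zero]
            intro hkl
            exact hk (hkl ▸ Fin.mk_le_mk.2 (by omega))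
          simp [this]
      · intro f hf
        have := h2 i f (fun j hj => hf ⟨j, hj⟩)
        have h3 := (abs_le.1 (hε f)).2
        rw [hBn]
        linarith
    · have := hlam i
      simp; linarith
  · have := le_of_adjoint_pair (n := i) A B hAB (fun k => φ k)
      (hφ.linearIndependent.comp _ Fin.val_injective)
      -- When i exceeds T the eigenvectors run out; the constraints are padded with zero vectors,
      -- matching the zeros appended to the eigenvalue list.
      (fun j => if hj : (j : ℕ) < Fintype.card (Fin T) then v ⟨j, hj⟩ else 0)
      (μ := lam i - ε) (ν := eigenvalueSeq hG i) hS0 ?_ ?_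
    · linarith
    · intro b
      have := h1 i b
      have h3 := (abs_le.1 (hε (∑ k, b k • φ k))).1
      rw [hBn]
      linarith
    · intro c hc
      have hc' : ∀ k : Fin (Fintype.card (Fin T)), (k : ℕ) < i → ⟪v k, c⟫ = 0 := fun k hk => by
        have := hc ⟨k, hk⟩
        simp only [k.2, dif_pos] at this
        exact this
      rw [hnorm, hnc, Finset.mul_sum]
      refine Finset.sum_le_sum fun k _ => ?_
      by_cases hk : (k : ℕ) < i
      · simp [hc' k hk]
      · refine mul_le_mul_of_nonneg_right ?_ (sq_nonneg _)
        have hi : i < Fintype.card (Fin T) := by omega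
        rw [eigenvalueSeq, dif_pos hi]
        exact hanti (Fin.le_def.2 (not_lt.1 hk))

/-- The quadratic form of `Q` is at least `lam i` on the span of the first `i + 1` eigenvectors. -/
lemma eigenvalue_mul_norm_sq_le {lam : ℕ → ℝ} (hanti : Antitone lam) {φ : ℕ → H}
    (hφ : Orthonormal ℝ φ) (Q : H →L[ℝ] H →L[ℝ] ℝ) (hQφ : ∀ i f, Q f (φ i) = lam i * ⟪f, φ i⟫)
    (i : ℕ) (b : Fin (i + 1) → ℝ) :
    lam i * ‖∑ k, b k • φ k‖ ^ 2 ≤ Q (∑ k, b k • φ k) (∑ k, b k • φ k) := by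
  have hφ' : Orthonormal ℝ fun k : Fin (i + 1) => φ k := hφ.comp _ Fin.val_injective
  have hin : ∀ k : Fin (i + 1), ⟪∑ l, b l • φ l, φ k⟫ = b k := fun k => by
    have := hφ'.inner_left_fintype b k
    simpa using this
  rw [← real_inner_self_eq_norm_sq]
  conv_lhs => enter [2]; rw [inner_sum]
  conv_rhs => rw [map_sum]
  simp only [inner_smul_right, map_smul, hQφ, hin, smul_eq_mul, Finset.mul_sum]
  refine Finset.sum_le_sum fun k _ => ?_
  have : lam i ≤ lam k := hanti (by omega)
  nlinarith [mul_self_nonneg (b k)]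

/-- The quadratic form of `Q` is at most `lam i` on the orthogonal complement of the first `i`
eigenvectors. -/
lemma le_eigenvalue_mul_norm_sq [CompleteSpace H] {lam : ℕ → ℝ} (hanti : Antitone lam)
    (hlam : ∀ i, 0 ≤ lam i) {φ : ℕ → H}
    (hφ : Orthonormal ℝ φ) (Q : H →L[ℝ] H →L[ℝ] ℝ) (hQ : ∀ f g, Q f g = Q g f)
    (hQφ : ∀ i f, Q f (φ i) = lam i * ⟪f, φ i⟫)
    (hQ0 : ∀ w, (∀ i, ⟪φ i, w⟫ = 0) → ∀ f, Q f w = 0)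
    (i : ℕ) (f : H) (hf : ∀ j < i, ⟪φ j, f⟫ = 0) : Q f f ≤ lam i * ‖f‖ ^ 2 := by
  -- The φ's need not be complete. Projecting f onto the closed span of the φ_j with j ≥ i leaves a
  -- remainder orthogonal to every φ_j, which `hQ0` removes from the form.
  let K : Submodule ℝ H := (Submodule.span ℝ (φ '' Set.Ici i)).topologicalClosure
  have hKc : IsClosed (K : Set H) := Submodule.isClosed_topologicalClosure _
  have : CompleteSpace K := hKc.completeSpace_coe
  have hKφ : ∀ x ∈ K, ∀ j < i, ⟪φ j, x⟫ = 0 := by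
    intro x hx j hj
    have hle : K ≤ (Submodule.span ℝ {φ j})ᗮ := by
      refine Submodule.topologicalClosure_minimal _ (Submodule.span_le.2 ?_)
        (Submodule.isClosed_orthogonal _)
      rintro _ ⟨k, hk, rfl⟩
      refine Submodule.mem_orthogonal_singleton_iff_inner_right.2 (hφ.2 ?_)
      have := Set.mem_Ici.1 hk
      omega
    exact Submodule.mem_orthogonal_singleton_iff_inner_right.1 (hle hx)
  -- The inequality defines a closed set, so finite combinations suffice; there the form is diagonal
  -- with entries at most `lam i`.
  have hKq : ∀ x ∈ K, Q x x ≤ lam i * ‖x‖ ^ 2 := by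
    have hcl : IsClosed {x : H | Q x x ≤ lam i * ‖x‖ ^ 2} :=
      isClosed_le (by fun_prop) (by fun_prop)
    intro x hx
    refine closure_minimal (t := {x : H | Q x x ≤ lam i * ‖x‖ ^ 2}) ?_ hcl
      (hx : x ∈ closure (Submodule.span ℝ (φ '' Set.Ici i) : Set H))
    intro y hy
    obtain ⟨c, hc, rfl⟩ := (Finsupp.mem_span_image_iff_linearCombination ℝ).1 hy
    simp only [Set.mem_ofPred_eq]
    have hin : ∀ k, ⟪Finsupp.linearCombination ℝ φ c, φ k⟫ = c k := fun k => by
      simpa using hφ.inner_left_finsupp c k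
    have hq : Q (Finsupp.linearCombination ℝ φ c) (Finsupp.linearCombination ℝ φ c) =
        ∑ k ∈ c.support, c k * (lam k * c k) := by
      conv_lhs => enter [2]; rw [Finsupp.linearCombination_apply, Finsupp.sum]
      simp [map_sum, hQφ, hin]
    have hn : ‖Finsupp.linearCombination ℝ φ c‖ ^ 2 = ∑ k ∈ c.support, c k * c k := by
      rw [← real_inner_self_eq_norm_sq]
      conv_lhs => enter [3]; rw [Finsupp.linearCombination_apply, Finsupp.sum]
      simp [inner_sum, inner_smul_right, hin]
    rw [hq, hn, Finset.mul_sum]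
    refine Finset.sum_le_sum fun k hk => ?_
    have : lam k ≤ lam i := hanti ((Finsupp.mem_supported _ _).1 hc hk)
    nlinarith [mul_self_nonneg (c k)]
  set k : H := K.starProjection f with hk
  have hkK : k ∈ K := Submodule.starProjection_apply_mem _ _
  have hr : ∀ j, ⟪φ j, f - k⟫ = 0 := by
    intro j
    by_cases hj : j < i
    · rw [inner_sub_right, hf j hj, hKφ k hkK j hj, sub_zero]
    · refine Submodule.mem_orthogonal _ _ |>.1 (K.sub_starProjection_mem_orthogonal f) _ ?_
      exact Submodule.le_topologicalClosure _ (Submodule.subset_span ⟨j, not_lt.1 hj, rfl⟩)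
  have hff : Q f f = Q k k := by
    have h1 : f = k + (f - k) := by abel
    have h2 := hQ0 _ hr f
    have h3 := hQ0 _ hr k
    rw [map_sub, sub_eq_zero] at h2 h3
    rw [h2, hQ, h3]
  have hkf : ‖k‖ ≤ ‖f‖ := K.norm_starProjection_apply_le f
  rw [hff]
  refine (hKq k hkK).trans ?_
  have := hlam i
  gcongr

end Eigenvalues

/-! ### Sample vectors as step functions in L²([0,1]). -/

section StepFunctions

/-- The real Hilbert space `L²([0,1])`. -/
abbrev L2I : Type := Lp ℝ 2 (volume : Measure I)

lemma coeFn_finset_sum {ι : Type*} (t : Finset ι) (f : ι → L2I) :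
    (⇑(∑ i ∈ t, f i) : I → ℝ) =ᵐ[volume] ∑ i ∈ t, ⇑(f i) := by
  classical
  induction t using Finset.induction_on with
  | empty => simpa using Lp.coeFn_zero ℝ 2 volume
  | insert a t ha ih =>
    rw [Finset.sum_insert ha, Finset.sum_insert ha]
    exact (Lp.coeFn_add _ _).trans (ih.mono fun r hr => by rw [Pi.add_apply, Pi.add_apply, hr])

/-- The set of `r ∈ [0,1]` with `i / n ≤ r < (i + 1) / n`. -/
def cell (n : ℕ) (i : ℕ) : Set I := {r | ⌊(n : ℝ) * r⌋₊ = i}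

lemma measurableSet_cell (n i : ℕ) : MeasurableSet (cell n i) :=
  (Nat.measurable_floor.comp (measurable_const.mul measurable_subtype_coe))
    (measurableSet_singleton i)

lemma volume_real_cell {n i : ℕ} (hi : i < n) : (volume : Measure I).real (cell n i) = (n : ℝ)⁻¹ := by
  have hn : (0 : ℝ) < n := by exact_mod_cast (Nat.zero_le i).trans_lt hi
  have hin : (i : ℝ) + 1 ≤ n := by exact_mod_cast hi
  have : (Subtype.val '' cell n i : Set ℝ) = Set.Ico ((i : ℝ) / n) ((i + 1) / n) := by
    ext x
    simp only [cell, Set.mem_image, Set.mem_ofPred_eq, Subtype.exists, exists_and_right,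
      exists_eq_right, Set.mem_Ico, div_le_iff₀ hn, lt_div_iff₀ hn]
    constructor
    · rintro ⟨⟨h0, h1⟩, h⟩
      rw [Nat.floor_eq_iff (by positivity)] at h
      constructor <;> linarith [h.1, h.2, mul_comm x (n : ℝ)]
    · rintro ⟨h1, h2⟩
      have h0 : 0 ≤ x := by
        by_contra! hx
        have : x * n < 0 := mul_neg_of_neg_of_pos hx hn
        have : (0 : ℝ) ≤ i := by positivity
        linarith
      refine ⟨⟨h0, ?_⟩, ?_⟩
      · have : x * n < 1 * n := by linarith
        exact (lt_of_mul_lt_mul_right this hn.le).le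
      · rw [Nat.floor_eq_iff (by positivity)]
        constructor <;> linarith [mul_comm x (n : ℝ)]
  rw [measureReal_def, unitInterval.volume_apply, this, Real.volume_Ico, ENNReal.toReal_ofReal]
  · field_simp; ring
  · rw [← sub_div]; ring_nf; positivity

/-- The normalised indicator function of a cell. -/
noncomputable def cellBasis (n : ℕ) (i : Fin n) : L2I :=
  √(n : ℝ) • indicatorConstLp 2 (measurableSet_cell n i) (measure_ne_top _ _) (1 : ℝ)

lemma orthonormal_cellBasis (n : ℕ) : Orthonormal ℝ (cellBasis n) := by
  rw [orthonormal_iff_ite]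
  intro i j
  have hn : (0 : ℝ) < n := by exact_mod_cast (Nat.zero_le _).trans_lt i.2
  rw [cellBasis, cellBasis, inner_smul_left, inner_smul_right,
    L2.real_inner_indicatorConstLp_one_indicatorConstLp_one]
  split_ifs with h
  · subst h
    rw [Set.inter_self, volume_real_cell i.2]
    simp only [conj_trivial]
    rw [← mul_assoc, Real.mul_self_sqrt hn.le, mul_inv_cancel₀ hn.ne']
  · have : cell n i ∩ cell n j = ∅ := by
      ext r
      simp only [cell, Set.mem_inter_iff, Set.mem_ofPred_eq, Set.mem_empty_iff_false, iff_false]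
      rintro ⟨h1, h2⟩
      exact h (Fin.ext (h1.symm.trans h2))
    simp [this]

/-- The step function with value `y i` on the `i`-th cell. -/
noncomputable def stepL2 {n : ℕ} (y : Fin n → ℝ) : L2I := ∑ i, (y i / √(n : ℝ)) • cellBasis n i

lemma stepL2_add {n : ℕ} (y z : Fin n → ℝ) :
    stepL2 (fun i => y i + z i) = stepL2 y + stepL2 z := by
  simp [stepL2, add_div, add_smul, Finset.sum_add_distrib]

lemma inner_stepL2 {n : ℕ} (y : Fin n → ℝ) (f : L2I) :
    ⟪stepL2 y, f⟫ = ∑ i, y i / √(n : ℝ) * ⟪cellBasis n i, f⟫ := by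
  simp [stepL2, sum_inner, inner_smul_left]

/-- Cells have length 1/n. This factor is the reason the Gram eigenvalues are divided by p. -/
lemma inner_stepL2_stepL2 {n : ℕ} (y z : Fin n → ℝ) :
    ⟪stepL2 y, stepL2 z⟫ = (n : ℝ)⁻¹ * ∑ i, y i * z i := by
  rw [inner_stepL2, Finset.mul_sum]
  refine Finset.sum_congr rfl fun i _ => ?_
  have hn : (0 : ℝ) < n := by exact_mod_cast (Nat.zero_le _).trans_lt i.2
  rw [stepL2, (orthonormal_cellBasis n).inner_right_fintype]
  field_simp
  rw [Real.sq_sqrt hn.le]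
  ring

/-- The truncation at n - 1 only makes the index legal at r = 1, a null set. -/
lemma stepL2_coeFn {n : ℕ} (hn : 0 < n) (y : Fin n → ℝ) :
    (stepL2 y : I → ℝ) =ᵐ[volume]
      fun r => y ⟨min ⌊(n : ℝ) * r⌋₊ (n - 1), by omega⟩ := by
  have h0 : (stepL2 y : I → ℝ) =ᵐ[volume]
      fun r => ∑ i : Fin n, y i * (cell n i).indicator (fun _ => (1 : ℝ)) r := by
    have hsum : (stepL2 y : I → ℝ) =ᵐ[volume]
        ∑ i : Fin n, ⇑((y i / √(n : ℝ)) • cellBasis n i) := by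
      exact coeFn_finset_sum _ _
    have hi : ∀ i : Fin n, (⇑((y i / √(n : ℝ)) • cellBasis n i) : I → ℝ) =ᵐ[volume]
        fun r => y i * (cell n i).indicator (fun _ => (1 : ℝ)) r := by
      intro i
      have hn' : (0 : ℝ) < √(n : ℝ) := Real.sqrt_pos.2 (by exact_mod_cast hn)
      rw [cellBasis, smul_smul, div_mul_cancel₀ _ hn'.ne']
      filter_upwards [Lp.coeFn_smul (y i) (indicatorConstLp 2 (measurableSet_cell n i)
        (measure_ne_top volume _) (1 : ℝ)), indicatorConstLp_coeFn (p := 2)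
        (hs := measurableSet_cell n i) (hμs := measure_ne_top volume _) (c := (1 : ℝ))] with r h1 h2
      rw [h1, Pi.smul_apply, h2, smul_eq_mul]
    filter_upwards [hsum, eventually_all.2 hi] with r h1 h2
    rw [h1, Finset.sum_apply]
    exact Finset.sum_congr rfl fun i _ => h2 i
  have h1 : ∀ᵐ r : I, r ≠ 1 := Measure.ae_ne _ _
  filter_upwards [h0, h1] with r h hr
  rw [h]
  have hr1 : (r : ℝ) < 1 := lt_of_le_of_ne r.2.2 fun h => hr (Subtype.ext h)
  have hfl : ⌊(n : ℝ) * r⌋₊ < n := by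
    rw [Nat.floor_lt (mul_nonneg (by positivity) r.2.1)]
    have : (0 : ℝ) < n := by exact_mod_cast hn
    nlinarith
  rw [Finset.sum_eq_single ⟨⌊(n : ℝ) * r⌋₊, hfl⟩]
  · rw [Set.indicator_of_mem (by simp [cell]), mul_one]
    congr 1
    simp; omega
  · intro i _ hi
    rw [Set.indicator_of_notMem, mul_zero]
    intro h
    exact hi (Fin.ext h.symm)
  · simp

lemma enorm_L2I_sq (z : L2I) : ‖z‖ₑ ^ 2 = ∫⁻ r, ‖z r‖ₑ ^ 2 := by
  rw [Lp.enorm_def]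
  have := eLpNorm_nnreal_pow_eq_lintegral (f := (z : I → ℝ)) (μ := volume) (p := 2) two_ne_zero
  simpa using this

/-- The sampling point assigned to `r ∈ [0,1]`. -/
noncomputable def sampleMap {n : ℕ} (hn : 0 < n) (s : Fin n → I) (r : I) : I :=
  s ⟨min ⌊(n : ℝ) * r⌋₊ (n - 1), by omega⟩

lemma measurable_sampleMap {n : ℕ} (hn : 0 < n) (s : Fin n → I) :
    Measurable (sampleMap hn s) := by
  let g : ℕ → I := fun k => s ⟨min k (n - 1), by omega⟩
  exact (measurable_from_top (f := g)).comp
    (Nat.measurable_floor.comp (measurable_const.mul measurable_subtype_coe))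

/-- Expresses the discretisation error through increments of the curve, so that Tonelli and the
increment condition apply. -/
lemma enorm_stepL2_sub_sq {n : ℕ} (hn : 0 < n) (s : Fin n → I) {x : I → ℝ} {z : L2I}
    (hz : x =ᵐ[volume] z) :
    ‖stepL2 (fun i => x (s i)) - z‖ₑ ^ 2 = ∫⁻ r, ‖x (sampleMap hn s r) - x r‖ₑ ^ 2 := by
  rw [enorm_L2I_sq]
  refine lintegral_congr_ae ?_
  filter_upwards [Lp.coeFn_sub (stepL2 fun i => x (s i)) z, stepL2_coeFn hn fun i => x (s i), hz]
    with r h1 h2 h3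
  rw [h1, Pi.sub_apply, h2, ← h3, sampleMap]

/-- The grid constraints give (n - 1)h ≤ 1 ≤ (n + 1)h. Hence ih is within 1/n of i/n, the offset
satisfies 0 ≤ a ≤ h ≤ 2/n, and r lies in [i/n, (i + 1)/n); together these give 3/n. -/
lemma abs_sampleMap_sub_le {n : ℕ} (hn : 2 ≤ n) {s : Fin n → I} (hs : IsEquidistant s) {r : I}
    (hr : r ≠ 1) : |(sampleMap (by omega) s r : ℝ) - r| ≤ 3 / n := by
  obtain ⟨a, h, hh, ha, han, hsi⟩ := hs
  have hn' : (2 : ℝ) ≤ n := by exact_mod_cast hn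
  have hr1 : (r : ℝ) < 1 := lt_of_le_of_ne r.2.2 fun h => hr (Subtype.ext h)
  have hr0 : (0 : ℝ) ≤ r := r.2.1
  have hfl : ⌊(n : ℝ) * r⌋₊ < n := by
    rw [Nat.floor_lt (mul_nonneg (by positivity) r.2.1)]
    nlinarith
  have ha0 : 0 ≤ a := by
    have := (s ⟨0, by omega⟩).2.1
    rw [hsi] at this; simpa using this
  have ha1 : a + (n - 1) * h ≤ 1 := by
    have := (s ⟨n - 1, by omega⟩).2.2
    rw [hsi] at this
    simpa [Nat.cast_sub (show 1 ≤ n by omega)] using this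
  set i := ⌊(n : ℝ) * r⌋₊ with hi
  have e1 : (sampleMap (by omega) s r : ℝ) = a + i * h := by
    rw [sampleMap, hsi]
    simp only [← hi]
    rw [min_eq_left (by omega)]
  have hi1 : (i : ℝ) ≤ n * r := Nat.floor_le (by positivity)
  have hi2 : (n : ℝ) * r < i + 1 := Nat.lt_floor_add_one _
  have hin : (i : ℝ) + 1 ≤ n := by exact_mod_cast hfl
  have hi0 : (0 : ℝ) ≤ i := by positivity
  have hih : i * h ≤ 1 := by nlinarith
  have hih0 : 0 ≤ i * h := by positivity
  have h1 : i * ((n - 1) * h) ≤ i * 1 := by gcongr; linarith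
  have h2 : i * 1 ≤ i * ((n + 1) * h) := by gcongr; linarith
  have h3 : n * a ≤ n * h := by gcongr
  have h4 : 1 * h ≤ (n - 1) * h := by gcongr; linarith
  have hn0 : (0 : ℝ) < n := by linarith
  have habs : |a + i * h - r| * n = |(a + i * h - r) * n| := by rw [abs_mul, abs_of_pos hn0]
  rw [e1, le_div_iff₀ hn0, habs, abs_le]
  have h5 : 0 ≤ n * a := by positivity
  constructor <;> nlinarith

end StepFunctions

/-! ### Calculus of stochastic orders. -/

section BigOP

variable {Ω : Type*} [MeasurableSpace Ω] {P : Measure Ω} {Z W : ℕ → Ω → ℝ} {r r' : ℕ → ℝ}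

/-- No measurability is required, so the supremum of the eigenvalue errors can be dominated
directly. -/
lemma IsBigOP.mono_ae (hW : IsBigOP P W r) (h : ∀ᶠ n in atTop, ∀ᵐ ω ∂P, |Z n ω| ≤ |W n ω|) :
    IsBigOP P Z r := by
  intro ε hε
  obtain ⟨M, hM⟩ := hW ε hε
  refine ⟨M, ?_⟩
  filter_upwards [hM, h] with n h1 h2
  refine (measure_mono_ae ?_).trans h1
  filter_upwards [h2] with ω hω h3
  exact lt_of_lt_of_le h3 hω

lemma IsBigOP.add (hZ : IsBigOP P Z r) (hW : IsBigOP P W r) :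
    IsBigOP P (fun n ω => Z n ω + W n ω) r := by
  intro ε hε
  obtain ⟨M, hM⟩ := hZ (ε / 2) (by positivity)
  obtain ⟨M', hM'⟩ := hW (ε / 2) (by positivity)
  refine ⟨M + M', ?_⟩
  filter_upwards [hM, hM'] with n h1 h2
  have hsub : {ω | (M + M') * r n < |Z n ω + W n ω|} ⊆
      {ω | M * r n < |Z n ω|} ∪ {ω | M' * r n < |W n ω|} := by
    intro ω hω
    simp only [Set.mem_ofPred_eq, Set.mem_union] at hω ⊢
    by_contra! hcon
    have := abs_add_le (Z n ω) (W n ω)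
    linarith [hcon.1, hcon.2]
  calc _ ≤ _ := measure_mono hsub
    _ ≤ _ := measure_union_le _ _
    _ ≤ ENNReal.ofReal (ε / 2) + ENNReal.ofReal (ε / 2) := add_le_add h1 h2
    _ = _ := by rw [← ENNReal.ofReal_add (by positivity) (by positivity)]; simp

lemma IsBigOP.mono_rate (hZ : IsBigOP P Z r) (hr : ∀ᶠ n in atTop, 0 ≤ r n ∧ r n ≤ r' n) :
    IsBigOP P Z r' := by
  intro ε hε
  obtain ⟨M, hM⟩ := hZ ε hε
  refine ⟨max M 0, ?_⟩
  filter_upwards [hM, hr] with n h1 h2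
  refine (measure_mono fun ω hω => ?_).trans h1
  simp only [Set.mem_ofPred_eq] at hω ⊢
  refine lt_of_le_of_lt ?_ hω
  exact mul_le_mul (le_max_left _ _) h2.2 h2.1 (le_max_right _ _)

/-- Markov's inequality at level M r_n with M = max(C, 1)/ε; the maximum keeps the level positive.
-/
lemma isBigOP_of_lintegral_le {C : ℝ} (hZ : ∀ᶠ n in atTop, AEMeasurable (Z n) P)
    (hr : ∀ᶠ n in atTop, 0 < r n)
    (h : ∀ᶠ n in atTop, ∫⁻ ω, ‖Z n ω‖ₑ ∂P ≤ ENNReal.ofReal (C * r n)) : IsBigOP P Z r := by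
  intro ε hε
  refine ⟨max C 1 / ε, ?_⟩
  filter_upwards [hZ, hr, h] with n h1 h2 h3
  have hC : 0 < max C 1 := lt_max_of_lt_right one_pos
  have hpos : 0 < max C 1 / ε * r n := by positivity
  calc P {ω | max C 1 / ε * r n < |Z n ω|}
      ≤ P {ω | ENNReal.ofReal (max C 1 / ε * r n) ≤ ‖Z n ω‖ₑ} := by
        refine measure_mono fun ω hω => ?_
        simp only [Set.mem_ofPred_eq] at hω ⊢
        rw [Real.enorm_eq_ofReal_abs]
        exact ENNReal.ofReal_le_ofReal hω.le
    _ ≤ (∫⁻ ω, ‖Z n ω‖ₑ ∂P) / ENNReal.ofReal (max C 1 / ε * r n) :=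
        meas_ge_le_lintegral_div h1.enorm (by simpa using hpos) ENNReal.ofReal_ne_top
    _ ≤ ENNReal.ofReal (C * r n) / ENNReal.ofReal (max C 1 / ε * r n) := by gcongr
    _ ≤ ENNReal.ofReal (max C 1 * r n) / ENNReal.ofReal (max C 1 / ε * r n) := by
        gcongr; exact le_max_left _ _
    _ = ENNReal.ofReal ε := by
        rw [← ENNReal.ofReal_div_of_pos hpos]
        congr 1
        field_simp

lemma isBigOP_of_integral_le {C : ℝ} (hZ0 : ∀ᶠ n in atTop, ∀ ω, 0 ≤ Z n ω)
    (hZ : ∀ᶠ n in atTop, Integrable (Z n) P) (hr : ∀ᶠ n in atTop, 0 < r n)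
    (h : ∀ᶠ n in atTop, ∫ ω, Z n ω ∂P ≤ C * r n) : IsBigOP P Z r := by
  refine isBigOP_of_lintegral_le (C := C) (hZ.mono fun n hn => hn.aestronglyMeasurable.aemeasurable)
    hr ?_
  filter_upwards [hZ0, hZ, h] with n h0 h1 h2
  have : ∀ ω, ‖Z n ω‖ₑ = ENNReal.ofReal (Z n ω) := fun ω => Real.enorm_eq_ofReal (h0 ω)
  simp_rw [this]
  rw [← ofReal_integral_eq_lintegral_ofReal h1 (ae_of_all _ h0)]
  exact ENNReal.ofReal_le_ofReal h2

lemma IsBigOP.sqrt (hZ : IsBigOP P Z fun n => r n ^ 2) (hr : ∀ n, 0 ≤ r n) :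
    IsBigOP P (fun n ω => √(Z n ω)) r := by
  intro ε hε
  obtain ⟨M, hM⟩ := hZ ε hε
  refine ⟨√(max M 0), ?_⟩
  filter_upwards [hM] with n h1
  refine (measure_mono fun ω hω => ?_).trans h1
  simp only [Set.mem_ofPred_eq] at hω ⊢
  rw [abs_of_nonneg (Real.sqrt_nonneg _)] at hω
  have h0 : 0 ≤ √(max M 0) * r n := mul_nonneg (Real.sqrt_nonneg _) (hr n)
  have h2 := (Real.lt_sqrt h0).1 hω
  rw [mul_pow, Real.sq_sqrt (le_max_right _ _)] at h2
  have h3 : M * r n ^ 2 ≤ max M 0 * r n ^ 2 := by gcongr; exact le_max_left _ _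
  exact (h3.trans_lt h2).trans_le (le_abs_self _)

/-- Convergence in probability of reciprocals at a vanishing rate. -/
lemma IsBigOP.tendstoInMeasure_inv {c : ℝ} (hc : c ≠ 0) (hr : Tendsto r atTop (𝓝 0))
    (h : IsBigOP P (fun n ω => c - W n ω) r) :
    TendstoInMeasure P (fun n ω => (W n ω)⁻¹) atTop fun _ => c⁻¹ := by
  rw [tendstoInMeasure_iff_norm]
  intro ε hε
  obtain ⟨d, hd, hd'⟩ := Metric.continuousAt_iff.1 (continuousAt_inv₀ hc) ε hε
  rw [ENNReal.tendsto_nhds_zero]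
  intro η hη
  obtain ⟨η', hη'0, hη'⟩ : ∃ η' : ℝ, 0 < η' ∧ ENNReal.ofReal η' ≤ η := by
    obtain ⟨q, hq0, hq⟩ := ENNReal.lt_iff_exists_real_btwn.1 hη
    exact ⟨q, by simpa using hq.1, hq.2.le⟩
  obtain ⟨M, hM⟩ := h η' hη'0
  have hMr : ∀ᶠ n in atTop, M * r n < d := by
    have : Tendsto (fun n => M * r n) atTop (𝓝 0) := by simpa using hr.const_mul M
    exact this.eventually_lt_const hd
  filter_upwards [hM, hMr] with n h1 h2
  refine (measure_mono fun ω hω => ?_).trans (h1.trans hη')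
  simp only [Set.mem_ofPred_eq] at hω ⊢
  by_contra! hcon
  have h3 : dist (W n ω) c < d := by
    rw [Real.dist_eq, abs_sub_comm]
    linarith
  have := hd' h3
  rw [Real.dist_eq] at this
  rw [Real.norm_eq_abs] at hω
  linarith

lemma isBigOP_one_of_tendstoInMeasure {c : ℝ} (h : TendstoInMeasure P Z atTop fun _ => c) :
    IsBigOP P Z fun _ => 1 := by
  intro ε hε
  refine ⟨|c| + 1, ?_⟩
  rw [tendstoInMeasure_iff_norm] at h
  have h1 := (ENNReal.tendsto_nhds_zero.1 (h 1 one_pos)) (ENNReal.ofReal ε) (by simpa using hε)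
  filter_upwards [h1] with n hn
  refine (measure_mono fun ω hω => ?_).trans hn
  simp only [Set.mem_ofPred_eq, Real.norm_eq_abs] at hω ⊢
  have := abs_sub_abs_le_abs_sub (Z n ω) c
  linarith

end BigOP

/-! ### Toeplitz sums and the Frobenius bound. -/

section Sums

/-- A Toeplitz double sum is bounded by `n` times the sum of the generating sequence. -/
lemma sum_sum_toeplitz_le {c : ℤ → ℝ} (hc : ∀ h, 0 ≤ c h) (hs : Summable c) (n : ℕ) :
    ∑ i : Fin n, ∑ j : Fin n, c ((i : ℤ) - j) ≤ n * ∑' h, c h := by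
  have : ∀ i : Fin n, ∑ j : Fin n, c ((i : ℤ) - j) ≤ ∑' h, c h := fun i => by
    have hinj : Function.Injective fun j : Fin n => (i : ℤ) - j := fun a b h => by
      simp only at h
      exact Fin.ext (by omega)
    rw [← tsum_fintype (L := .unconditional _)]
    exact (hs.comp_injective hinj).tsum_le_tsum_of_inj _ hinj (fun _ _ => hc _) (fun _ => le_rfl) hs
  calc _ ≤ ∑ _i : Fin n, ∑' h, c h := Finset.sum_le_sum fun i _ => this i
    _ = _ := by simp

/-- A bilinear form is bounded by the Frobenius norm of its matrix. -/
lemma abs_sum_sum_mul_le {ι κ : Type*} [Fintype ι] [Fintype κ] (M : ι → κ → ℝ) (x : ι → ℝ)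
    (y : κ → ℝ) {N : ℝ} (hx : ∑ i, x i ^ 2 ≤ N) (hy : ∑ j, y j ^ 2 ≤ N) :
    |∑ i, ∑ j, M i j * (x i * y j)| ≤ √(∑ i, ∑ j, M i j ^ 2) * N := by
  have hN : 0 ≤ N := (Finset.sum_nonneg fun i _ => sq_nonneg (x i)).trans hx
  refine Real.abs_le_sqrt ?_ |>.trans (le_of_eq ?_) (b := √((∑ i, ∑ j, M i j ^ 2) * N ^ 2))
  -- Cauchy–Schwarz over index pairs, against the rank-one array x_i y_j.
  · have h1 := Finset.sum_mul_sq_le_sq_mul_sq Finset.univ (fun p : ι × κ => M p.1 p.2)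
      (fun p : ι × κ => x p.1 * y p.2)
    rw [Fintype.sum_prod_type, Fintype.sum_prod_type, Fintype.sum_prod_type] at h1
    refine h1.trans ?_
    have h2 : ∑ i, ∑ j, (x i * y j) ^ 2 = (∑ i, x i ^ 2) * ∑ j, y j ^ 2 := by
      rw [Finset.sum_mul_sum]
      simp_rw [mul_pow]
    have h3 : ∑ i, ∑ j, (x i * y j) ^ 2 ≤ N ^ 2 := by
      rw [h2, sq N]
      exact mul_le_mul hx hy (Finset.sum_nonneg fun j _ => sq_nonneg _) hN
    exact mul_le_mul_of_nonneg_left h3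
      (Finset.sum_nonneg fun i _ => Finset.sum_nonneg fun j _ => sq_nonneg _)
  · rw [Real.sqrt_mul' _ (sq_nonneg N), Real.sqrt_sq hN]

end Sums

/-! ### Second moments of sums over time. -/

section SecondMoments

variable {Ω : Type*} [MeasurableSpace Ω] {P : Measure Ω}

/-- Second moment of a sum of pairwise independent variables with mean `m`. -/
lemma integral_sum_sq_le_of_indep [IsProbabilityMeasure P] {T : ℕ} {w : Fin T → Ω → ℝ} (hw : ∀ t, MemLp (w t) 2 P)
    (hind : Pairwise fun t t' => IndepFun (w t) (w t') P) {m C : ℝ} (hm : ∀ t, ∫ ω, w t ω ∂P = m)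
    (hC : ∀ t, ∫ ω, w t ω ^ 2 ∂P ≤ C) :
    ∫ ω, (∑ t, w t ω) ^ 2 ∂P ≤ T * C + T ^ 2 * m ^ 2 := by
  have hS : MemLp (∑ t, w t) 2 P := memLp_finsetSum' _ fun t _ => hw t
  have h1 := variance_eq_sub hS
  have h2 : Var[∑ t, w t; P] = ∑ t, Var[w t; P] :=
    IndepFun.variance_sum (fun t _ => hw t) fun t _ t' _ h => hind h
  have h3 : ∀ t, Var[w t; P] ≤ C := fun t => by
    have := variance_eq_sub (hw t)
    simp only [Pi.pow_apply] at this
    nlinarith [hC t, sq_nonneg (∫ ω, w t ω ∂P)]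
  have h4 : ∫ ω, (∑ t, w t) ω ∂P = T * m := by
    simp only [Finset.sum_apply]
    rw [integral_finsetSum _ fun t _ => (hw t).integrable one_le_two]
    simp [hm]
  have h5 : ∑ t, Var[w t; P] ≤ T * C := by
    calc _ ≤ ∑ _t : Fin T, C := Finset.sum_le_sum fun t _ => h3 t
      _ = _ := by simp
  simp only [Pi.pow_apply, Finset.sum_apply] at h1 h4
  rw [h4, h2] at h1
  nlinarith

lemma integrable_sum_sq {T : ℕ} {w : Fin T → Ω → ℝ} (hw : ∀ t, MemLp (w t) 2 P) :
    Integrable (fun ω => (∑ t, w t ω) ^ 2) P := by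
  have hS : MemLp (fun ω => ∑ t, w t ω) 2 P := memLp_finsetSum _ fun t _ => hw t
  exact hS.integrable_sq

/-- Second moment of `∑ x_t v_t` for independent families, the second one being orthogonal. -/
lemma integral_sum_mul_sq_le {T : ℕ} {x v : Fin T → Ω → ℝ} (hx : ∀ t, MemLp (x t) 2 P)
    (hv : ∀ t, MemLp (v t) 2 P) (hind : IndepFun (fun ω t => x t ω) (fun ω t => v t ω) P)
    (hvv : ∀ t t', t ≠ t' → ∫ ω, v t ω * v t' ω ∂P = 0) {Cx Cv : ℝ}
    (hCx : ∀ t, ∫ ω, x t ω ^ 2 ∂P ≤ Cx) (hCv : ∀ t, ∫ ω, v t ω ^ 2 ∂P ≤ Cv) :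
    Integrable (fun ω => (∑ t, x t ω * v t ω) ^ 2) P ∧
      ∫ ω, (∑ t, x t ω * v t ω) ^ 2 ∂P ≤ T * (Cx * Cv) := by
  have hexp : ∀ ω, (∑ t, x t ω * v t ω) ^ 2 =
      ∑ t, ∑ t', (x t ω * x t' ω) * (v t ω * v t' ω) := fun ω => by
    rw [sq, Finset.sum_mul_sum]
    exact Finset.sum_congr rfl fun t _ => Finset.sum_congr rfl fun t' _ => by ring
  have hi : ∀ t t', IndepFun (fun ω => x t ω * x t' ω) (fun ω => v t ω * v t' ω) P := fun t t' =>
    hind.comp (φ := fun f : Fin T → ℝ => f t * f t') (ψ := fun f : Fin T → ℝ => f t * f t')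
      (by fun_prop) (by fun_prop)
  have hxx : ∀ t t', Integrable (fun ω => x t ω * x t' ω) P := fun t t' =>
    (hx t).integrable_mul (hx t')
  have hvi : ∀ t t', Integrable (fun ω => v t ω * v t' ω) P := fun t t' =>
    (hv t).integrable_mul (hv t')
  have hI : ∀ t t', Integrable (fun ω => (x t ω * x t' ω) * (v t ω * v t' ω)) P := fun t t' =>
    (hi t t').integrable_mul (hxx t t') (hvi t t')
  simp_rw [hexp]
  refine ⟨integrable_finsetSum _ fun t _ => integrable_finsetSum _ fun t' _ => hI t t', ?_⟩
  rw [integral_finsetSum _ fun t _ => integrable_finsetSum _ fun t' _ => hI t t']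
  calc _ ≤ ∑ _t : Fin T, Cx * Cv := ?_
    _ = _ := by simp
  refine Finset.sum_le_sum fun t _ => ?_
  rw [integral_finsetSum _ fun t' _ => hI t t']
  have hmul : ∀ t', ∫ ω, (x t ω * x t' ω) * (v t ω * v t' ω) ∂P =
      (∫ ω, x t ω * x t' ω ∂P) * ∫ ω, v t ω * v t' ω ∂P := fun t' =>
    (hi t t').integral_fun_mul_eq_mul_integral (hxx t t').aestronglyMeasurable
      (hvi t t').aestronglyMeasurable
  -- Independence factorises each mixed moment and orthogonality of v leaves only the diagonal,
  -- whatever the dependence within x.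
  rw [Finset.sum_eq_single t (fun t' _ h => by rw [hmul, hvv t t' h.symm, mul_zero]) (by simp), hmul]
  have h1 := hCx t
  have h2 := hCv t
  simp only [sq] at h1 h2
  exact mul_le_mul h1 h2 (integral_nonneg fun ω => mul_self_nonneg _)
    ((integral_nonneg fun ω => mul_self_nonneg _).trans h1)

end SecondMoments

/-! ### Stationarity and moment bounds uniform in time. -/

section Signal

variable {Ω : Type*} [MeasurableSpace Ω] {P : Measure Ω} {S : Type*} [MeasurableSpace S]
  {X : ℕ → I → Ω → ℝ} {L : ℕ}

/-- Iterates the one-step shift, so that bounds assumed for the initial curve hold at every time. -/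
lemma SignalAssumption.identDistrib_shift (h : SignalAssumption S P X L) (t : ℕ) :
    IdentDistrib (fun ω (q : ℕ × I) => X (q.1 + t) q.2 ω)
      (fun ω (q : ℕ × I) => X q.1 q.2 ω) P P := by
  induction t with
  | zero =>
    exact .refl h.stationary.aemeasurable_snd
  | succ t ih =>
    have h1 := h.stationary.comp (u := fun (f : ℕ × I → ℝ) (q : ℕ × I) => f (q.1 + t, q.2))
      (measurable_pi_lambda _ fun q => measurable_pi_apply _)
    exact IdentDistrib.trans h1 ih

lemma SignalAssumption.identDistrib_pair (h : SignalAssumption S P X L) (t : ℕ) (s s' : I) :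
    IdentDistrib (fun ω => (X t s ω, X t s' ω)) (fun ω => (X 0 s ω, X 0 s' ω)) P P := by
  have := (h.identDistrib_shift t).comp (u := fun (f : ℕ × I → ℝ) => (f (0, s), f (0, s')))
    (by fun_prop)
  simpa [Function.comp_def] using this

lemma SignalAssumption.identDistrib_eval (h : SignalAssumption S P X L) (t : ℕ) (s : I) :
    IdentDistrib (X t s) (X 0 s) P P :=
  (h.identDistrib_pair t s s).comp (u := Prod.fst) measurable_fst

lemma SignalAssumption.memLp_four (h : SignalAssumption S P X L) (t : ℕ) (s : I) :
    MemLp (X t s) 4 P := by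
  obtain ⟨C, hC⟩ := h.fourth_moment
  exact (h.identDistrib_eval t s).memLp_iff.2 (hC s).1

lemma SignalAssumption.memLp_two [IsProbabilityMeasure P] (h : SignalAssumption S P X L) (t : ℕ) (s : I) :
    MemLp (X t s) 2 P :=
  (h.memLp_four t s).mono_exponent (by norm_num)

lemma SignalAssumption.fourth_moment_le (h : SignalAssumption S P X L) :
    ∃ C : ℝ, 0 ≤ C ∧ ∀ t s, ∫ ω, X t s ω ^ 4 ∂P ≤ C := by
  obtain ⟨C, hC⟩ := h.fourth_moment
  refine ⟨max C 0, le_max_right _ _, fun t s => ?_⟩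
  have := ((h.identDistrib_eval t s).comp (u := fun x => x ^ 4) (by fun_prop)).integral_eq
  simp only [Function.comp_def] at this
  rw [this]
  exact (hC s).2.trans (le_max_left _ _)

lemma integrable_pow_four {f : Ω → ℝ} (hf : MemLp f 4 P) : Integrable (fun ω => f ω ^ 4) P := by
  have := hf.integrable_norm_pow (by norm_num)
  refine this.congr (ae_of_all _ fun ω => ?_)
  simp only [Real.norm_eq_abs]
  exact (by decide : Even 4).pow_abs _

lemma integral_sq_le_of_fourth [IsProbabilityMeasure P] {f : Ω → ℝ} (hf : MemLp f 4 P) {C : ℝ}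
    (hC : ∫ ω, f ω ^ 4 ∂P ≤ C) : ∫ ω, f ω ^ 2 ∂P ≤ 1 + C := by
  have h2 : MemLp f 2 P := hf.mono_exponent (by norm_num)
  have h4 := integrable_pow_four hf
  calc ∫ ω, f ω ^ 2 ∂P ≤ ∫ ω, (1 + f ω ^ 4) ∂P := by
        refine integral_mono h2.integrable_sq ((integrable_const _).add h4) fun ω => ?_
        simp only
        nlinarith [sq_nonneg (f ω ^ 2 - 1), sq_nonneg (f ω ^ 2)]
    _ = 1 + ∫ ω, f ω ^ 4 ∂P := by rw [integral_add (integrable_const _) h4]; simp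
    _ ≤ _ := by gcongr

lemma SignalAssumption.second_moment_le [IsProbabilityMeasure P] (h : SignalAssumption S P X L) :
    ∃ C : ℝ, 0 ≤ C ∧ ∀ t s, ∫ ω, X t s ω ^ 2 ∂P ≤ C := by
  obtain ⟨C, hC0, hC⟩ := h.fourth_moment_le
  exact ⟨1 + C, by positivity, fun t s => integral_sq_le_of_fourth (h.memLp_four t s) (hC t s)⟩

lemma SignalAssumption.increment_le (h : SignalAssumption S P X L)
    (hInc : IncrementCondition P (X 0)) :
    ∃ C η : ℝ, 0 ≤ C ∧ 0 < η ∧ ∀ t, ∀ s s' : I, |(s' : ℝ) - s| ≤ η →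
      ∫ ω, (X t s' ω - X t s ω) ^ 2 ∂P ≤ C * |(s' : ℝ) - s| := by
  obtain ⟨C, η, hη, hC⟩ := hInc
  refine ⟨max C 0, η, le_max_right _ _, hη, fun t s s' hss => ?_⟩
  have := ((h.identDistrib_pair t s s').comp (u := fun x => (x.2 - x.1) ^ 2)
    (by fun_prop)).integral_eq
  simp only [Function.comp_def] at this
  rw [this]
  refine (hC s s' hss).trans ?_
  gcongr
  exact le_max_left _ _

end Signal

/-! ### Frobenius norms of the noise and cross covariance matrices. -/

section Noise

variable {Ω : Type*} [MeasurableSpace Ω] {P : Measure Ω}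
  {X : ℕ → I → Ω → ℝ} {p : ℕ → ℕ} {u : (T : ℕ) → Fin T → Fin (p T) → Ω → ℝ} {γ : ℤ → ℝ}

lemma NoiseAssumption.hasGaussianLaw (h : NoiseAssumption P X p u γ) (T : ℕ) (t : Fin T)
    (i : Fin (p T)) : HasGaussianLaw (u T t i) P :=
  (h.gaussian T t).eval i

lemma NoiseAssumption.memLp_four (h : NoiseAssumption P X p u γ) (T : ℕ) (t : Fin T)
    (i : Fin (p T)) : MemLp (u T t i) 4 P :=
  (h.hasGaussianLaw T t i).memLp (by norm_num)

lemma NoiseAssumption.memLp_two (h : NoiseAssumption P X p u γ) (T : ℕ) (t : Fin T)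
    (i : Fin (p T)) : MemLp (u T t i) 2 P :=
  (h.hasGaussianLaw T t i).memLp_two

lemma NoiseAssumption.integral_mul [IsProbabilityMeasure P] (h : NoiseAssumption P X p u γ) (T : ℕ) (t : Fin T)
    (i j : Fin (p T)) : ∫ ω, u T t i ω * u T t j ω ∂P = γ ((i : ℤ) - j) := by
  have := covariance_eq_sub (h.memLp_two T t i) (h.memLp_two T t j)
  rw [h.cov_eq, h.mean_zero, h.mean_zero] at this
  simpa using this.symm

lemma NoiseAssumption.integral_sq [IsProbabilityMeasure P] (h : NoiseAssumption P X p u γ) (T : ℕ) (t : Fin T)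
    (i : Fin (p T)) : ∫ ω, u T t i ω ^ 2 ∂P = γ 0 := by
  have := h.integral_mul T t i i
  rw [sub_self] at this
  simpa [sq] using this

lemma NoiseAssumption.map_eq (h : NoiseAssumption P X p u γ) (T : ℕ) (t : Fin T)
    (i : Fin (p T)) : P.map (u T t i) = gaussianReal 0 (γ 0).toNNReal := by
  rw [(h.hasGaussianLaw T t i).map_eq_gaussianReal, h.mean_zero,
    ← covariance_self (h.hasGaussianLaw T t i).aemeasurable, h.cov_eq, sub_self]

/-- All errors share the law N(0, γ(0)), so one fourth-moment constant serves for all T, t and i. -/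
lemma NoiseAssumption.integral_pow_four (h : NoiseAssumption P X p u γ) (T : ℕ) (t : Fin T)
    (i : Fin (p T)) :
    ∫ ω, u T t i ω ^ 4 ∂P = ∫ x, x ^ 4 ∂(gaussianReal 0 (γ 0).toNNReal) := by
  rw [← h.map_eq T t i, integral_map (h.hasGaussianLaw T t i).aemeasurable (by fun_prop)]

lemma NoiseAssumption.memLp_mul (h : NoiseAssumption P X p u γ) (T : ℕ) (t : Fin T)
    (i j : Fin (p T)) : MemLp (fun ω => u T t i ω * u T t j ω) 2 P := by
  have hi := (h.memLp_four T t i)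
  have hj := (h.memLp_four T t j)
  refine (memLp_two_iff_integrable_sq (hi.aestronglyMeasurable.mul hj.aestronglyMeasurable)).2 ?_
  refine Integrable.mono' ((integrable_pow_four hi).add (integrable_pow_four hj))
    ((hi.aestronglyMeasurable.mul hj.aestronglyMeasurable).pow 2) (ae_of_all _ fun ω => ?_)
  simp only [Pi.add_apply, Pi.mul_apply, Real.norm_eq_abs]
  rw [abs_of_nonneg (by positivity)]
  nlinarith [sq_nonneg (u T t i ω ^ 2 - u T t j ω ^ 2), sq_nonneg (u T t i ω ^ 2),
    sq_nonneg (u T t j ω ^ 2)]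

lemma NoiseAssumption.integral_mul_sq_le (h : NoiseAssumption P X p u γ) (T : ℕ) (t : Fin T)
    (i j : Fin (p T)) :
    ∫ ω, (u T t i ω * u T t j ω) ^ 2 ∂P ≤ ∫ x, x ^ 4 ∂(gaussianReal 0 (γ 0).toNNReal) := by
  have hi := integrable_pow_four (h.memLp_four T t i)
  have hj := integrable_pow_four (h.memLp_four T t j)
  calc ∫ ω, (u T t i ω * u T t j ω) ^ 2 ∂P
      ≤ ∫ ω, (1 / 2 * u T t i ω ^ 4 + 1 / 2 * u T t j ω ^ 4) ∂P := by
        refine integral_mono (h.memLp_mul T t i j).integrable_sq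
          ((hi.const_mul _).add (hj.const_mul _)) fun ω => ?_
        simp only
        nlinarith [sq_nonneg (u T t i ω ^ 2 - u T t j ω ^ 2)]
    _ = _ := by
        rw [integral_add (hi.const_mul _) (hj.const_mul _), integral_const_mul, integral_const_mul,
          h.integral_pow_four, h.integral_pow_four]
        ring

/-- The sample covariance matrix of the errors, divided by `p`. -/
noncomputable def noiseMatrix (u : (T : ℕ) → Fin T → Fin (p T) → Ω → ℝ) (T : ℕ) (ω : Ω)
    (i j : Fin (p T)) : ℝ := ((p T : ℝ) * T)⁻¹ * ∑ t, u T t i ω * u T t j ω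

/-- The sample cross covariance matrix of signals and errors, divided by `p`. -/
noncomputable def crossMatrix (X : ℕ → I → Ω → ℝ) (s : (T : ℕ) → Fin (p T) → I)
    (u : (T : ℕ) → Fin T → Fin (p T) → Ω → ℝ) (T : ℕ) (ω : Ω)
    (i j : Fin (p T)) : ℝ := ((p T : ℝ) * T)⁻¹ * ∑ t : Fin T, X t (s T i) ω * u T t j ω

lemma NoiseAssumption.integrable_noiseMatrix (h : NoiseAssumption P X p u γ) (T : ℕ) :
    Integrable (fun ω => ∑ i, ∑ j, noiseMatrix u T ω i j ^ 2) P := by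
  refine integrable_finsetSum _ fun i _ => integrable_finsetSum _ fun j _ => ?_
  simp only [noiseMatrix, mul_pow]
  exact (integrable_sum_sq fun t => h.memLp_mul T t i j).const_mul _

/-- Entry (i, j) averages T independent products of mean γ(i - j). Over p² entries scaled by 1/p²,
the variances contribute K/T, and the squared means form a Toeplitz sum of size at most pG,
contributing G/p. -/
lemma NoiseAssumption.integral_noiseMatrix_le [IsProbabilityMeasure P] (h : NoiseAssumption P X p u γ) :
    ∃ C : ℝ, ∀ T, 0 < T → 0 < p T →
      ∫ ω, ∑ i, ∑ j, noiseMatrix u T ω i j ^ 2 ∂P ≤ C * (1 / p T + 1 / T) := by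
  set K := ∫ x, x ^ 4 ∂(gaussianReal 0 (γ 0).toNNReal) with hK
  have hK0 : 0 ≤ K := integral_nonneg fun x => by positivity
  -- Absolute summability forces |γ(h)| ≤ 1 for all but finitely many h, where γ(h)² ≤ |γ(h)|.
  have hsum : Summable fun h => γ h ^ 2 := by
    refine Summable.of_norm_bounded_eventually (g := fun k => |γ k|) h.summable ?_
    have := h.summable.tendsto_cofinite_zero.eventually_le_const (show (0 : ℝ) < 1 by norm_num)
    filter_upwards [this] with k hk
    rw [Real.norm_eq_abs, abs_of_nonneg (sq_nonneg _), ← sq_abs]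
    nlinarith [abs_nonneg (γ k)]
  set G := ∑' k, γ k ^ 2 with hG
  have hG0 : 0 ≤ G := tsum_nonneg fun k => sq_nonneg _
  refine ⟨K + G, fun T hT hp => ?_⟩
  have hT' : (0 : ℝ) < T := by exact_mod_cast hT
  have hp' : (0 : ℝ) < p T := by exact_mod_cast hp
  have hint : ∀ i j : Fin (p T), Integrable (fun ω => noiseMatrix u T ω i j ^ 2) P := fun i j => by
    simp only [noiseMatrix, mul_pow]
    exact (integrable_sum_sq fun t => h.memLp_mul T t i j).const_mul _
  rw [integral_finsetSum _ fun i _ => integrable_finsetSum _ fun j _ => hint i j]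
  have h1 : ∀ i j : Fin (p T), ∫ ω, noiseMatrix u T ω i j ^ 2 ∂P ≤
      (((p T : ℝ) * T)⁻¹) ^ 2 * (T * K + T ^ 2 * γ ((i : ℤ) - j) ^ 2) := fun i j => by
    simp only [noiseMatrix, mul_pow]
    rw [integral_const_mul]
    refine mul_le_mul_of_nonneg_left ?_ (by positivity)
    refine integral_sum_sq_le_of_indep (fun t => h.memLp_mul T t i j) (fun t t' htt => ?_)
      (fun t => h.integral_mul T t i j) fun t => h.integral_mul_sq_le T t i j
    exact ((h.iIndep T).indepFun htt).comp (φ := fun f : Fin (p T) → ℝ => f i * f j)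
      (ψ := fun f : Fin (p T) → ℝ => f i * f j)
      (by fun_prop) (by fun_prop)
  calc _ ≤ ∑ i : Fin (p T), ∑ j : Fin (p T),
        (((p T : ℝ) * T)⁻¹) ^ 2 * (T * K + T ^ 2 * γ ((i : ℤ) - j) ^ 2) := by
        refine Finset.sum_le_sum fun i _ => ?_
        rw [integral_finsetSum _ fun j _ => hint i j]
        exact Finset.sum_le_sum fun j _ => h1 i j
    _ = (((p T : ℝ) * T)⁻¹) ^ 2 * ((p T : ℝ) ^ 2 * (T * K) +
        T ^ 2 * ∑ i : Fin (p T), ∑ j : Fin (p T), γ ((i : ℤ) - j) ^ 2) := by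
        simp only [← Finset.mul_sum, Finset.sum_add_distrib, Finset.sum_const, Finset.card_univ,
          Fintype.card_fin, nsmul_eq_mul]
        ring
    _ ≤ (((p T : ℝ) * T)⁻¹) ^ 2 * ((p T : ℝ) ^ 2 * (T * K) + T ^ 2 * (p T * G)) := by
        gcongr
        exact sum_sum_toeplitz_le (fun k => sq_nonneg (γ k)) hsum _
    _ = K * (1 / T) + G * (1 / p T) := by field_simp
    _ ≤ _ := by
        have : 0 ≤ K * (1 / p T) := by positivity
        have : 0 ≤ G * (1 / (T : ℝ)) := by positivity
        linarith

lemma NoiseAssumption.integral_mul_of_ne (h : NoiseAssumption P X p u γ) (T : ℕ) {t t' : Fin T}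
    (htt : t ≠ t') (i : Fin (p T)) : ∫ ω, u T t i ω * u T t' i ω ∂P = 0 := by
  have : IndepFun (u T t i) (u T t' i) P := ((h.iIndep T).indepFun htt).comp
    (φ := fun f : Fin (p T) → ℝ => f i)
    (ψ := fun f : Fin (p T) → ℝ => f i)
      (measurable_pi_apply i) (measurable_pi_apply i)
  have h2 := this.integral_fun_mul_eq_mul_integral (h.memLp_two T t i).aestronglyMeasurable
    (h.memLp_two T t' i).aestronglyMeasurable
  rw [h2, h.mean_zero, zero_mul]

/-- Errors at different times are uncorrelated and independent of the signals, so each of the p²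
entries has second moment at most Cγ(0)/(p²T). -/
lemma integral_crossMatrix_le [IsProbabilityMeasure P] {S : Type*} [MeasurableSpace S] {L : ℕ}
    (h : NoiseAssumption P X p u γ) (hX : SignalAssumption S P X L)
    (s : (T : ℕ) → Fin (p T) → I) :
    (∀ T, Integrable (fun ω => ∑ i, ∑ j, crossMatrix X s u T ω i j ^ 2) P) ∧
    ∃ C : ℝ, ∀ T, 0 < T → 0 < p T →
      ∫ ω, ∑ i, ∑ j, crossMatrix X s u T ω i j ^ 2 ∂P ≤ C * (1 / T) := by
  obtain ⟨C, hC0, hC⟩ := hX.second_moment_le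
  have key : ∀ T, ∀ i j : Fin (p T), _ := fun T i j =>
    integral_sum_mul_sq_le (x := fun t : Fin T => X t (s T i)) (v := fun t => u T t j)
      (fun t => hX.memLp_two t (s T i)) (fun t => h.memLp_two T t j)
      ((h.indep_signal T).symm.comp (φ := fun (f : ℕ × I → ℝ) (t : Fin T) => f ((t : ℕ), s T i))
        (ψ := fun (f : Fin T × Fin (p T) → ℝ) (t : Fin T) => f (t, j)) (by fun_prop) (by fun_prop))
      (fun t t' htt => h.integral_mul_of_ne T htt j) (fun t => hC t (s T i))
      (fun t => (h.integral_sq T t j).le)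
  have hint : ∀ T, ∀ i j : Fin (p T), Integrable (fun ω => crossMatrix X s u T ω i j ^ 2) P :=
    fun T i j => by
      simp only [crossMatrix, mul_pow]
      exact (key T i j).1.const_mul _
  refine ⟨fun T => integrable_finsetSum _ fun i _ => integrable_finsetSum _ fun j _ =>
    hint T i j, C * γ 0, fun T hT hp => ?_⟩
  have hT' : (0 : ℝ) < T := by exact_mod_cast hT
  have hp' : (0 : ℝ) < p T := by exact_mod_cast hp
  rw [integral_finsetSum _ fun i _ => integrable_finsetSum _ fun j _ => hint T i j]
  calc _ ≤ ∑ i : Fin (p T), ∑ j : Fin (p T), (((p T : ℝ) * T)⁻¹) ^ 2 * (T * (C * γ 0)) := by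
        refine Finset.sum_le_sum fun i _ => ?_
        rw [integral_finsetSum _ fun j _ => hint T i j]
        refine Finset.sum_le_sum fun j _ => ?_
        simp only [crossMatrix, mul_pow]
        rw [integral_const_mul]
        exact mul_le_mul_of_nonneg_left (key T i j).2 (by positivity)
    _ = _ := by
        simp
        field_simp

end Noise

/-! ### Coupling and the covariance decay of coordinate products. -/

section Coupling

variable {Ω S H : Type*} [MeasurableSpace Ω] [MeasurableSpace S] [NormedAddCommGroup H]
  {P : Measure Ω}

/-- The innovations up to time `t`, in reversed order. -/
def past (δ : ℤ → Ω → S) (t : ℤ) (ω : Ω) (k : ℕ) : S := δ (t - k) ω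

/-- The sequence that agrees with `x` up to index `m + 1` and with `y` afterwards. -/
def mix (m : ℕ) (x y : ℕ → S) (k : ℕ) : S := if k ≤ m + 1 then x k else y k

lemma measurable_mix (m : ℕ) : Measurable fun z : (ℕ → S) × (ℕ → S) => mix m z.1 z.2 := by
  refine measurable_pi_lambda _ fun k => ?_
  unfold mix
  split_ifs
  · exact (measurable_pi_apply k).comp measurable_fst
  · exact (measurable_pi_apply k).comp measurable_snd

lemma measurable_past {δ : ℤ → Ω → S} (hδ : ∀ t, Measurable (δ t)) (t : ℤ) :
    Measurable (past δ t) :=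
  measurable_pi_lambda _ fun _ => hδ _

/-- The law is a product measure free of t; this is what moves every norm to time 0. -/
lemma map_past {δ : ℤ → Ω → S} (hδ : ∀ t, Measurable (δ t)) (hi : iIndepFun δ P)
    (hid : ∀ t, IdentDistrib (δ t) (δ 0) P P) (t : ℤ) :
    P.map (past δ t) = Measure.infinitePi fun _ : ℕ => P.map (δ 0) := by
  have hinj : Function.Injective fun k : ℕ => t - (k : ℤ) := fun a b h => by
    simp only at h
    omega
  have h := (hi.precomp hinj).map_fun_eq_infinitePi_map (fun k => hδ _)
  have h2 : ∀ k : ℕ, P.map (δ (t - k)) = P.map (δ 0) := fun k => (hid _).map_eq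
  simp only [h2] at h
  exact h

lemma identDistrib_past [IsProbabilityMeasure P] {δ : ℤ → Ω → S} (hδ : ∀ t, Measurable (δ t)) (hi : iIndepFun δ P)
    (hid : ∀ t, IdentDistrib (δ t) (δ 0) P P) (t : ℤ) :
    IdentDistrib (past δ t) (past δ 0) P P where
  aemeasurable_fst := (measurable_past hδ t).aemeasurable
  aemeasurable_snd := (measurable_past hδ 0).aemeasurable
  map_eq := by rw [map_past hδ hi hid, map_past hδ hi hid]

lemma identDistrib_past_prod [IsProbabilityMeasure P] {δ : ℤ → Ω → S} (hδ : ∀ t, Measurable (δ t)) (hi : iIndepFun δ P)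
    (hid : ∀ t, IdentDistrib (δ t) (δ 0) P P) (t : ℤ) :
    IdentDistrib (fun w : Ω × Ω => (past δ t w.1, past δ t w.2))
      (fun w : Ω × Ω => (past δ 0 w.1, past δ 0 w.2)) (P.prod P) (P.prod P) where
  aemeasurable_fst := ((measurable_past hδ t).prodMap (measurable_past hδ t)).aemeasurable
  aemeasurable_snd := ((measurable_past hδ 0).prodMap (measurable_past hδ 0)).aemeasurable
  map_eq := by
    have h : ∀ t, (P.prod P).map (fun w : Ω × Ω => (past δ t w.1, past δ t w.2)) =
        (P.map (past δ t)).prod (P.map (past δ t)) := fun t =>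
      (Measure.map_prod_map _ _ (measurable_past hδ t) (measurable_past hδ t)).symm
    rw [h, h, map_past hδ hi hid, map_past hδ hi hid]

lemma eLpNorm_comp_eq_of_identDistrib {Ω' E : Type*} [MeasurableSpace Ω'] [MeasurableSpace E]
    {μ : Measure Ω} {ν : Measure Ω'} {f : Ω → E} {f' : Ω' → E} (h : IdentDistrib f f' μ ν)
    {q : ENNReal} {G : E → H} (hG : StronglyMeasurable G) :
    eLpNorm (fun ω => G (f ω)) q μ = eLpNorm (fun ω => G (f' ω)) q ν := by
  have h1 := eLpNorm_map_measure (p := q) (f := f) (μ := μ) hG.aestronglyMeasurable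
    h.aemeasurable_fst
  have h2 := eLpNorm_map_measure (p := q) (f := f') (μ := ν) hG.aestronglyMeasurable
    h.aemeasurable_snd
  rw [h.map_eq, h2] at h1
  exact h1.symm

/-- The innovations up to time `t` are independent of the coupled innovations at a later time. -/
lemma indepFun_past_mix {δ : ℤ → Ω → S} (hδ : ∀ t, Measurable (δ t)) (hi : iIndepFun δ P)
    (t : ℤ) (m : ℕ) (y : ℕ → S) :
    IndepFun (past δ t) (fun ω => mix m (past δ (t + (m + 2)) ω) y) P := by
  -- The coupled sequence keeps coordinates 0 to m + 1, which at time t + m + 2 are the innovations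
  -- at times t + 1 to t + m + 2; the others are the constant y. This fixes the lag m + 2.
  have h := indep_iSup_of_disjoint (fun j => (hδ j).comap_le) hi
    (S := Set.Iic t) (T := Set.Ioi t) (Set.Iic_disjoint_Ioi le_rfl)
  have key : ∀ (A : Set ℤ) (j : ℤ), j ∈ A →
      Measurable[⨆ i ∈ A, MeasurableSpace.comap (δ i) inferInstance] (δ j) := fun A j hj =>
    (comap_measurable (δ j)).mono
      (le_iSup₂_of_le (f := fun i (_ : i ∈ A) => MeasurableSpace.comap (δ i) inferInstance)
        j hj le_rfl) le_rfl
  refine indep_of_indep_of_le_left (indep_of_indep_of_le_right h ?_) ?_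
  · refine Measurable.comap_le ?_
    refine @measurable_pi_lambda _ _ _ (_) _ _ fun k => ?_
    unfold mix past
    split_ifs with hk
    · exact key _ _ (by simp; omega)
    · exact @measurable_const _ _ _ (_) _
  · refine Measurable.comap_le ?_
    refine @measurable_pi_lambda _ _ _ (_) _ _ fun k => ?_
    exact key _ _ (by simp)

lemma eLpNorm_comp_fst [IsProbabilityMeasure P] {f : Ω → H} (hf : AEStronglyMeasurable f P)
    (q : ENNReal) : eLpNorm (fun w : Ω × Ω => f w.1) q (P.prod P) = eLpNorm f q P :=
  eLpNorm_comp_measurePreserving hf measurePreserving_fst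

variable [InnerProductSpace ℝ H]

/-- The product of two coordinates of a vector. -/
def coordMul (e e' z : H) : ℝ := ⟪e, z⟫ * ⟪e', z⟫

lemma abs_coordMul_sub_le (e e' z z' : H) :
    |coordMul e e' z - coordMul e e' z'| ≤ ‖e‖ * ‖e'‖ * (‖z - z'‖ * (‖z‖ + ‖z'‖)) := by
  have h : coordMul e e' z - coordMul e e' z' =
      ⟪e, z - z'⟫ * ⟪e', z⟫ + ⟪e, z'⟫ * ⟪e', z - z'⟫ := by
    simp only [coordMul, inner_sub_right]; ring
  rw [h]
  calc _ ≤ |⟪e, z - z'⟫| * |⟪e', z⟫| + |⟪e, z'⟫| * |⟪e', z - z'⟫| := by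
        rw [← abs_mul, ← abs_mul]; exact abs_add_le _ _
    _ ≤ (‖e‖ * ‖z - z'‖) * (‖e'‖ * ‖z‖) + (‖e‖ * ‖z'‖) * (‖e'‖ * ‖z - z'‖) := by
        gcongr <;> exact abs_real_inner_le_norm _ _
    _ = _ := by ring

lemma continuous_coordMul (e e' : H) : Continuous (coordMul e e') := by
  unfold coordMul; fun_prop

lemma holderTriple_four_four_two : ENNReal.HolderTriple 4 4 2 where
  inv_add_inv_eq_inv := by
    have h : (4 : ENNReal) = 2 * 2 := by norm_num
    rw [h, ENNReal.mul_inv (by simp) (by simp), ← two_mul, ← mul_assoc,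
      ENNReal.mul_inv_cancel (by simp) (by simp), one_mul]

lemma memLp_coordMul {μ : Measure Ω} {z : Ω → H} (hz : MemLp z 4 μ) (e e' : H) :
    MemLp (fun ω => coordMul e e' (z ω)) 2 μ := by
  have := holderTriple_four_four_two
  have h1 : MemLp (fun ω => ⟪e, z ω⟫) 4 μ := hz.const_inner e
  have h2 : MemLp (fun ω => ⟪e', z ω⟫) 4 μ := hz.const_inner e'
  exact h2.mul h1

/-- A difference of coordinate products is at most a constant times ‖z - z'‖(‖z‖ + ‖z'‖); Hölder is
applied as 1 = 1/2 + 1/2, then 1/2 = 1/4 + 1/4. -/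
lemma eLpNorm_mul_coordMul_sub_le {μ : Measure Ω} {A : Ω → ℝ} {z z' : Ω → H}
    (hA : AEStronglyMeasurable A μ) (hz : AEStronglyMeasurable z μ)
    (hz' : AEStronglyMeasurable z' μ) (e e' : H) :
    eLpNorm (fun ω => A ω * (coordMul e e' (z ω) - coordMul e e' (z' ω))) 1 μ ≤
      ENNReal.ofReal (‖e‖ * ‖e'‖) * (eLpNorm A 2 μ *
        (eLpNorm (fun ω => z ω - z' ω) 4 μ * (eLpNorm z 4 μ + eLpNorm z' 4 μ))) := by
  have := holderTriple_four_four_two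
  have hN : AEStronglyMeasurable (fun ω => ‖z ω‖ + ‖z' ω‖) μ := hz.norm.add hz'.norm
  have hd : AEStronglyMeasurable (fun ω => ‖z ω - z' ω‖) μ := (hz.sub hz').norm
  have h1 : eLpNorm (fun ω => ‖z ω‖ + ‖z' ω‖) 4 μ ≤ eLpNorm z 4 μ + eLpNorm z' 4 μ := by
    refine (eLpNorm_add_le hz.norm hz'.norm (by norm_num)).trans ?_
    rw [eLpNorm_norm, eLpNorm_norm]
  have h2 : eLpNorm (fun ω => ‖z ω - z' ω‖ * (‖z ω‖ + ‖z' ω‖)) 2 μ ≤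
      eLpNorm (fun ω => z ω - z' ω) 4 μ * (eLpNorm z 4 μ + eLpNorm z' 4 μ) := by
    refine (eLpNorm_smul_le_mul_eLpNorm (p := 4) (q := 4) (r := 2) hN hd).trans ?_
    rw [eLpNorm_norm]
    gcongr
  calc _ ≤ eLpNorm ((‖e‖ * ‖e'‖) • fun ω => A ω * (‖z ω - z' ω‖ * (‖z ω‖ + ‖z' ω‖))) 1 μ := by
        refine eLpNorm_mono fun ω => ?_
        simp only [Real.norm_eq_abs, Pi.smul_apply, smul_eq_mul, abs_mul]
        have := abs_coordMul_sub_le e e' (z ω) (z' ω)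
        rw [abs_of_nonneg (norm_nonneg e), abs_of_nonneg (norm_nonneg e'),
          abs_of_nonneg (norm_nonneg (z ω - z' ω)), abs_of_nonneg (show 0 ≤ ‖z ω‖ + ‖z' ω‖ by positivity)]
        calc _ ≤ |A ω| * (‖e‖ * ‖e'‖ * (‖z ω - z' ω‖ * (‖z ω‖ + ‖z' ω‖))) := by gcongr
          _ = _ := by ring
    _ = ENNReal.ofReal (‖e‖ * ‖e'‖) *
        eLpNorm (fun ω => A ω * (‖z ω - z' ω‖ * (‖z ω‖ + ‖z' ω‖))) 1 μ := by
        rw [eLpNorm_const_smul, Real.enorm_eq_ofReal (by positivity)]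
    _ ≤ _ := by
        gcongr
        refine (eLpNorm_smul_le_mul_eLpNorm (p := 2) (q := 2) (r := 1) (hd.mul hN) hA).trans ?_
        gcongr
        exact h2

/-- Covariances of products of coordinates at lag `m + 2`, in terms of the coupling distance. -/
lemma abs_integral_mul_coordMul_le [IsProbabilityMeasure P] {δ : ℤ → Ω → S} (hδ : ∀ t, Measurable (δ t))
    (hi : iIndepFun δ P) (hid : ∀ t, IdentDistrib (δ t) (δ 0) P P) {g : (ℕ → S) → H}
    (hg : StronglyMeasurable g) (hg4 : MemLp (fun ω => g (past δ 0 ω)) 4 P) (m : ℕ)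
    (ha : eLpNorm (fun w : Ω × Ω => g (past δ 0 w.1) - g (mix m (past δ 0 w.1) (past δ 0 w.2)))
      4 (P.prod P) < ⊤) (e e' : H) (t : ℤ) :
    ENNReal.ofReal |∫ ω, (coordMul e e' (g (past δ t ω)) -
        ∫ ω, coordMul e e' (g (past δ 0 ω)) ∂P) *
        coordMul e e' (g (past δ (t + (m + 2)) ω)) ∂P| ≤
      ENNReal.ofReal (‖e‖ * ‖e'‖) *
        (eLpNorm (fun ω => coordMul e e' (g (past δ 0 ω)) -
          ∫ ω, coordMul e e' (g (past δ 0 ω)) ∂P) 2 P *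
        (eLpNorm (fun w : Ω × Ω =>
          g (past δ 0 w.1) - g (mix m (past δ 0 w.1) (past δ 0 w.2))) 4 (P.prod P) *
        (2 * eLpNorm (fun ω => g (past δ 0 ω)) 4 P + eLpNorm (fun w : Ω × Ω =>
          g (past δ 0 w.1) - g (mix m (past δ 0 w.1) (past δ 0 w.2))) 4 (P.prod P)))) := by
  set μ := ∫ ω, coordMul e e' (g (past δ 0 ω)) ∂P with hμ
  set a := eLpNorm (fun w : Ω × Ω => g (past δ 0 w.1) - g (mix m (past δ 0 w.1) (past δ 0 w.2)))
      4 (P.prod P) with ha_def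
  set t' : ℤ := t + (m + 2) with ht'
  have hF : StronglyMeasurable fun x => coordMul e e' (g x) :=
    (continuous_coordMul e e').comp_stronglyMeasurable hg
  have hFμ : StronglyMeasurable fun x => coordMul e e' (g x) - μ := hF.sub stronglyMeasurable_const
  let z : Ω × Ω → H := fun w => g (past δ t' w.1)
  let z' : Ω × Ω → H := fun w => g (mix m (past δ t' w.1) (past δ t' w.2))
  let A : Ω × Ω → ℝ := fun w => coordMul e e' (g (past δ t w.1)) - μ
  have hfst : ∀ t, Measurable fun w : Ω × Ω => past δ t w.1 := fun t =>
    (measurable_past hδ t).comp measurable_fst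
  have hsnd : ∀ t, Measurable fun w : Ω × Ω => past δ t w.2 := fun t =>
    (measurable_past hδ t).comp measurable_snd
  have hmix : Measurable fun w : Ω × Ω => mix m (past δ t' w.1) (past δ t' w.2) :=
    (measurable_mix m).comp ((hfst t').prodMk (hsnd t'))
  have hzm : StronglyMeasurable z := hg.comp_measurable (hfst t')
  have hzm' : StronglyMeasurable z' := hg.comp_measurable hmix
  have hAm : StronglyMeasurable A := hFμ.comp_measurable (hfst t)
  have hgt : ∀ t, eLpNorm (fun ω => g (past δ t ω)) 4 P = eLpNorm (fun ω => g (past δ 0 ω)) 4 P :=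
    fun t => eLpNorm_comp_eq_of_identDistrib (identDistrib_past hδ hi hid t) hg
  have hzn : eLpNorm z 4 (P.prod P) = eLpNorm (fun ω => g (past δ 0 ω)) 4 P := by
    rw [← hgt t']
    exact eLpNorm_comp_fst (hg.comp_measurable (measurable_past hδ t')).aestronglyMeasurable 4
  have hAn : eLpNorm A 2 (P.prod P) =
      eLpNorm (fun ω => coordMul e e' (g (past δ 0 ω)) - μ) 2 P := by
    rw [← eLpNorm_comp_eq_of_identDistrib (identDistrib_past hδ hi hid t) hFμ]
    exact eLpNorm_comp_fst (hFμ.comp_measurable (measurable_past hδ t)).aestronglyMeasurable 2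
  have hdn : eLpNorm (fun w => z w - z' w) 4 (P.prod P) = a := by
    have hG : StronglyMeasurable fun x : (ℕ → S) × (ℕ → S) => g x.1 - g (mix m x.1 x.2) :=
      (hg.comp_measurable measurable_fst).sub (hg.comp_measurable (measurable_mix m))
    have h := eLpNorm_comp_eq_of_identDistrib (q := 4) (identDistrib_past_prod hδ hi hid t') hG
    simp only at h
    rw [ha_def, ← h]
  have hzn' : eLpNorm z' 4 (P.prod P) ≤ eLpNorm (fun ω => g (past δ 0 ω)) 4 P + a := by
    have : z' = fun w => z w - (z w - z' w) := by funext w; abel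
    rw [this, ← hzn, ← hdn]
    exact eLpNorm_sub_le hzm.aestronglyMeasurable (hzm.sub hzm').aestronglyMeasurable
      (by norm_num)
  have hzL : MemLp z 4 (P.prod P) := ⟨hzm.aestronglyMeasurable, by rw [hzn]; exact hg4.2⟩
  have hzL' : MemLp z' 4 (P.prod P) := ⟨hzm'.aestronglyMeasurable,
    hzn'.trans_lt (ENNReal.add_lt_top.2 ⟨hg4.2, ha⟩)⟩
  have hAL : MemLp A 2 (P.prod P) := by
    refine ⟨hAm.aestronglyMeasurable, ?_⟩
    rw [hAn]
    exact ((memLp_coordMul hg4 e e').sub (memLp_const μ)).2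
  have hAB : Integrable (fun w => A w * coordMul e e' (z w)) (P.prod P) :=
    hAL.integrable_mul (memLp_coordMul hzL e e')
  have hAB' : Integrable (fun w => A w * coordMul e e' (z' w)) (P.prod P) :=
    hAL.integrable_mul (memLp_coordMul hzL' e e')
  have hmean : ∫ ω, (coordMul e e' (g (past δ t ω)) - μ) ∂P = 0 := by
    have h1 := ((identDistrib_past hδ hi hid t).comp hFμ.measurable).integral_eq
    simp only [Function.comp_def] at h1
    rw [h1, integral_sub ((memLp_coordMul hg4 e e').integrable one_le_two) (integrable_const _)]
    simp [hμ]
  -- For each fixed second coordinate the coupled value is independent of the past up to t, and A is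
  -- centred. Only the coupling error z - z' then contributes to the covariance.
  have hzero : ∫ w, A w * coordMul e e' (z' w) ∂(P.prod P) = 0 := by
    rw [integral_prod_symm _ hAB']
    refine integral_eq_zero_of_ae (ae_of_all _ fun y => ?_)
    have hin := (indepFun_past_mix hδ hi t m (past δ t' y)).comp hFμ.measurable hF.measurable
    have h2 := hin.integral_fun_mul_eq_mul_integral
      (hFμ.comp_measurable (measurable_past hδ t)).aestronglyMeasurable
      (hF.comp_measurable ((measurable_mix m).comp
        ((measurable_past hδ t').prodMk measurable_const))).aestronglyMeasurable
    simp only [Function.comp_def] at h2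
    simp only [A, z', Pi.zero_apply]
    rw [h2, hmean, zero_mul]
  have hfinal : ∫ ω, (coordMul e e' (g (past δ t ω)) - μ) * coordMul e e' (g (past δ t' ω)) ∂P =
      ∫ w, A w * (coordMul e e' (z w) - coordMul e e' (z' w)) ∂(P.prod P) := by
    simp_rw [mul_sub]
    rw [integral_sub hAB hAB', hzero, sub_zero]
    exact (integral_fun_fst (μ := P) (ν := P) fun ω =>
      (coordMul e e' (g (past δ t ω)) - μ) * coordMul e e' (g (past δ t' ω))).trans (by simp) |>.symm
  rw [hfinal, ← Real.enorm_eq_ofReal_abs]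
  refine (enorm_integral_le_lintegral_enorm _).trans ?_
  rw [← eLpNorm_one_eq_lintegral_enorm]
  refine (eLpNorm_mul_coordMul_sub_le hAm.aestronglyMeasurable hzm.aestronglyMeasurable
    hzm'.aestronglyMeasurable e e').trans ?_
  rw [hAn, hdn, hzn, two_mul, add_assoc]
  gcongr

/-- Covariances of products of coordinates are summable over the lags. -/
lemma exists_summable_abs_integral_le [IsProbabilityMeasure P] {δ : ℤ → Ω → S}
    (hδ : ∀ t, Measurable (δ t)) (hi : iIndepFun δ P)
    (hid : ∀ t, IdentDistrib (δ t) (δ 0) P P) {g : (ℕ → S) → H}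
    (hg : StronglyMeasurable g) (hg4 : MemLp (fun ω => g (past δ 0 ω)) 4 P)
    (ha : ∑' m, eLpNorm (fun w : Ω × Ω =>
      g (past δ 0 w.1) - g (mix m (past δ 0 w.1) (past δ 0 w.2))) 4 (P.prod P) < ⊤) (e e' : H) :
    ∃ c : ℕ → ℝ, Summable c ∧ (∀ h, 0 ≤ c h) ∧ ∀ (t : ℤ) (h : ℕ),
      |∫ ω, (coordMul e e' (g (past δ t ω)) - ∫ ω, coordMul e e' (g (past δ 0 ω)) ∂P) *
        (coordMul e e' (g (past δ (t + h) ω)) - ∫ ω, coordMul e e' (g (past δ 0 ω)) ∂P) ∂P| ≤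
        c h := by
  set μ := ∫ ω, coordMul e e' (g (past δ 0 ω)) ∂P with hμ
  set a : ℕ → ENNReal := fun m => eLpNorm (fun w : Ω × Ω =>
      g (past δ 0 w.1) - g (mix m (past δ 0 w.1) (past δ 0 w.2))) 4 (P.prod P) with ha_def
  have ham : ∀ m, a m ≤ ∑' m, a m := fun m => ENNReal.le_tsum m
  have hFμ : StronglyMeasurable fun x => coordMul e e' (g x) - μ :=
    ((continuous_coordMul e e').comp_stronglyMeasurable hg).sub stronglyMeasurable_const
  have hid' : ∀ t, IdentDistrib (fun ω => coordMul e e' (g (past δ t ω)) - μ)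
      (fun ω => coordMul e e' (g (past δ 0 ω)) - μ) P P := fun t =>
    (identDistrib_past hδ hi hid t).comp hFμ.measurable
  have hL0 : MemLp (fun ω => coordMul e e' (g (past δ 0 ω)) - μ) 2 P :=
    (memLp_coordMul hg4 e e').sub (memLp_const μ)
  have hL : ∀ t, MemLp (fun ω => coordMul e e' (g (past δ t ω)) - μ) 2 P := fun t =>
    (hid' t).memLp_iff.2 hL0
  have hmean : ∀ t, ∫ ω, (coordMul e e' (g (past δ t ω)) - μ) ∂P = 0 := fun t => by
    rw [(hid' t).integral_eq, integral_sub ((memLp_coordMul hg4 e e').integrable one_le_two)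
      (integrable_const _)]
    simp [hμ]
  set C0 := ∫ ω, (coordMul e e' (g (past δ 0 ω)) - μ) ^ 2 ∂P with hC0
  have hC00 : 0 ≤ C0 := integral_nonneg fun ω => sq_nonneg _
  have hsq : ∀ t, ∫ ω, (coordMul e e' (g (past δ t ω)) - μ) ^ 2 ∂P = C0 := fun t =>
    ((hid' t).comp (u := fun x => x ^ 2) (by fun_prop)).integral_eq
  set K : ENNReal := ENNReal.ofReal (‖e‖ * ‖e'‖) *
    (eLpNorm (fun ω => coordMul e e' (g (past δ 0 ω)) - μ) 2 P *
      (2 * eLpNorm (fun ω => g (past δ 0 ω)) 4 P + ∑' m, a m)) with hK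
  have hKtop : K ≠ ⊤ := by
    refine ENNReal.mul_ne_top ENNReal.ofReal_ne_top (ENNReal.mul_ne_top hL0.2.ne
      (ENNReal.add_ne_top.2 ⟨ENNReal.mul_ne_top (by simp) hg4.2.ne, ha.ne⟩))
  -- Coupling starts at lag 2; lags 0 and 1 are bounded by the variance.
  let c : ℕ → ℝ := fun h => if h < 2 then C0 else K.toReal * (a (h - 2)).toReal
  refine ⟨c, ?_, fun h => ?_, fun t h => ?_⟩
  · rw [← summable_nat_add_iff 2]
    have : (fun n => c (n + 2)) = fun n => K.toReal * (a n).toReal := by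
      funext n
      simp [c]
    rw [this]
    exact (ENNReal.summable_toReal ha.ne).mul_left _
  · simp only [c]
    split_ifs
    · exact hC00
    · positivity
  · simp only [c]
    split_ifs with hh
    · refine abs_integral_le_integral_abs.trans ?_
      calc _ ≤ ∫ ω, (1 / 2 * (coordMul e e' (g (past δ t ω)) - μ) ^ 2 +
            1 / 2 * (coordMul e e' (g (past δ (t + h) ω)) - μ) ^ 2) ∂P := by
            refine integral_mono ((hL t).integrable_mul (hL (t + h))).abs
              (((hL t).integrable_sq.const_mul _).add ((hL (t + h)).integrable_sq.const_mul _))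
              fun ω => ?_
            simp only
            rw [abs_le]
            constructor <;>
            nlinarith [sq_nonneg (coordMul e e' (g (past δ t ω)) - μ -
                (coordMul e e' (g (past δ (t + h) ω)) - μ)),
              sq_nonneg (coordMul e e' (g (past δ t ω)) - μ +
                (coordMul e e' (g (past δ (t + h) ω)) - μ))]
        _ = C0 := by
            rw [integral_add ((hL t).integrable_sq.const_mul _)
              ((hL (t + h)).integrable_sq.const_mul _), integral_const_mul, integral_const_mul,
              hsq, hsq]
            ring
    · obtain ⟨m, rfl⟩ : ∃ m, h = m + 2 := ⟨h - 2, by omega⟩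
      have h1 := abs_integral_mul_coordMul_le hδ hi hid hg hg4 m ((ham m).trans_lt ha) e e' t
      rw [← hμ] at h1
      -- Centring the second factor changes nothing, because the first has mean zero.
      have h2 : ∫ ω, (coordMul e e' (g (past δ t ω)) - μ) *
          (coordMul e e' (g (past δ (t + ((m + 2 : ℕ) : ℤ)) ω)) - μ) ∂P =
          ∫ ω, (coordMul e e' (g (past δ t ω)) - μ) *
          coordMul e e' (g (past δ (t + (m + 2)) ω)) ∂P := by
        have h3 : ∀ ω, (coordMul e e' (g (past δ t ω)) - μ) *
          coordMul e e' (g (past δ (t + (m + 2)) ω)) =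
          (coordMul e e' (g (past δ t ω)) - μ) *
          (coordMul e e' (g (past δ (t + ((m + 2 : ℕ) : ℤ)) ω)) - μ) +
          μ * (coordMul e e' (g (past δ t ω)) - μ) := fun ω => by push_cast; ring
        have hI : Integrable (fun ω => (coordMul e e' (g (past δ t ω)) - μ) *
          (coordMul e e' (g (past δ (t + ((m + 2 : ℕ) : ℤ)) ω)) - μ)) P :=
          (hL t).integrable_mul (hL _)
        simp_rw [h3]
        rw [integral_add hI (((hL t).integrable one_le_two).const_mul _), integral_const_mul, hmean, mul_zero,
          add_zero]
      rw [h2, Nat.add_sub_cancel, ← ENNReal.toReal_mul,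
        ← ENNReal.ofReal_le_iff_le_toReal (ENNReal.mul_ne_top hKtop ((ham m).trans_lt ha).ne)]
      refine h1.trans ?_
      calc _ ≤ ENNReal.ofReal (‖e‖ * ‖e'‖) *
            (eLpNorm (fun ω => coordMul e e' (g (past δ 0 ω)) - μ) 2 P *
              (a m * (2 * eLpNorm (fun ω => g (past δ 0 ω)) 4 P + ∑' m, a m))) := by
            gcongr
            exact ham m
        _ = _ := by rw [hK]; ring

/-- The sample second moments of the coordinates of an `L⁴`-`m`-approximable sequence converge at
the rate `T^{-1/2}` in mean square. -/
lemma exists_integral_sum_coordMul_sq_le [IsProbabilityMeasure P] {δ : ℤ → Ω → S}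
    (hδ : ∀ t, Measurable (δ t)) (hi : iIndepFun δ P)
    (hid : ∀ t, IdentDistrib (δ t) (δ 0) P P) {g : (ℕ → S) → H}
    (hg : StronglyMeasurable g) (hg4 : MemLp (fun ω => g (past δ 0 ω)) 4 P)
    (ha : ∑' m, eLpNorm (fun w : Ω × Ω =>
      g (past δ 0 w.1) - g (mix m (past δ 0 w.1) (past δ 0 w.2))) 4 (P.prod P) < ⊤) (e e' : H) :
    ∃ C : ℝ, ∀ T : ℕ,
      Integrable (fun ω => (∑ t : Fin T, (coordMul e e' (g (past δ (t : ℕ) ω)) -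
        ∫ ω, coordMul e e' (g (past δ 0 ω)) ∂P)) ^ 2) P ∧
      ∫ ω, (∑ t : Fin T, (coordMul e e' (g (past δ (t : ℕ) ω)) -
        ∫ ω, coordMul e e' (g (past δ 0 ω)) ∂P)) ^ 2 ∂P ≤ T * C := by
  obtain ⟨c, hcs, hc0, hc⟩ := exists_summable_abs_integral_le hδ hi hid hg hg4 ha e e'
  set μ := ∫ ω, coordMul e e' (g (past δ 0 ω)) ∂P with hμ
  have hFμ : StronglyMeasurable fun x => coordMul e e' (g x) - μ :=
    ((continuous_coordMul e e').comp_stronglyMeasurable hg).sub stronglyMeasurable_const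
  have hL : ∀ t, MemLp (fun ω => coordMul e e' (g (past δ t ω)) - μ) 2 P := fun t =>
    ((identDistrib_past hδ hi hid t).comp hFμ.measurable).memLp_iff.2
      ((memLp_coordMul hg4 e e').sub (memLp_const μ))
  -- The lag bounds are extended evenly to ℤ to apply the Toeplitz estimate.
  have hcZ : Summable fun h : ℤ => c h.natAbs :=
    Summable.of_nat_of_neg (by simpa using hcs) (by simpa using hcs)
  refine ⟨∑' h : ℤ, c h.natAbs, fun T => ⟨integrable_sum_sq fun t => hL _, ?_⟩⟩
  have hexp : ∀ ω, (∑ t : Fin T, (coordMul e e' (g (past δ (t : ℕ) ω)) - μ)) ^ 2 =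
      ∑ t : Fin T, ∑ t' : Fin T, (coordMul e e' (g (past δ (t : ℕ) ω)) - μ) *
        (coordMul e e' (g (past δ (t' : ℕ) ω)) - μ) := fun ω => by
    rw [sq, Finset.sum_mul_sum]
  have hI : ∀ t t' : Fin T, Integrable (fun ω => (coordMul e e' (g (past δ (t : ℕ) ω)) - μ) *
        (coordMul e e' (g (past δ (t' : ℕ) ω)) - μ)) P := fun t t' =>
    (hL _).integrable_mul (hL _)
  simp_rw [hexp]
  rw [integral_finsetSum _ fun t _ => integrable_finsetSum _ fun t' _ => hI t t']
  refine le_trans (Finset.sum_le_sum fun t _ => ?_)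
    (sum_sum_toeplitz_le (c := fun h => c h.natAbs) (fun h => hc0 _) hcZ T)
  rw [integral_finsetSum _ fun t' _ => hI t t']
  refine Finset.sum_le_sum fun t' _ => (le_abs_self _).trans ?_
  rcases le_total t t' with h | h
  · have h1 := hc (t : ℕ) (t' - t : ℕ)
    have h2 : ((t : ℕ) : ℤ) + ((t' - t : ℕ) : ℤ) = (t' : ℕ) := by
      have : (t : ℕ) ≤ t' := h
      omega
    rw [h2] at h1
    have h3 : (((t : ℕ) : ℤ) - (t' : ℕ)).natAbs = t' - t := by
      have : (t : ℕ) ≤ t' := h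
      omega
    rw [h3]
    exact h1
  · have h1 := hc (t' : ℕ) (t - t' : ℕ)
    have h2 : ((t' : ℕ) : ℤ) + ((t - t' : ℕ) : ℤ) = (t : ℕ) := by
      have : (t' : ℕ) ≤ t := h
      omega
    rw [h2] at h1
    have h3 : (((t : ℕ) : ℤ) - (t' : ℕ)).natAbs = t - t' := by
      have : (t' : ℕ) ≤ t := h
      omega
    rw [h3]
    simp_rw [mul_comm (coordMul e e' (g (past δ ((t : ℕ) : ℤ) _)) - μ)]
    exact h1

end Coupling

/-! ### Curves as random elements of L²([0,1]). -/

section SignalCurves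

variable {Ω : Type*} [MeasurableSpace Ω] {P : Measure Ω} {S : Type*}
  [MeasurableSpace S] {X : ℕ → I → Ω → ℝ} {L : ℕ}

lemma lintegral_enorm_pow_le {f : Ω → ℝ} {n : ℕ} (hn : Even n)
    (hf : Integrable (fun ω => f ω ^ n) P) {C : ℝ} (hC : ∫ ω, f ω ^ n ∂P ≤ C) :
    ∫⁻ ω, ‖f ω‖ₑ ^ n ∂P ≤ ENNReal.ofReal C := by
  have h : ∀ ω, ‖f ω‖ₑ ^ n = ENNReal.ofReal (f ω ^ n) := fun ω => by
    rw [← enorm_pow, Real.enorm_eq_ofReal (hn.pow_nonneg _)]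
  simp_rw [h]
  rw [← ofReal_integral_eq_lintegral_ofReal hf (ae_of_all _ fun ω => hn.pow_nonneg _)]
  exact ENNReal.ofReal_le_ofReal hC

/-- Joint square integrability of a curve. -/
lemma SignalAssumption.memLp_prod [IsProbabilityMeasure P] (h : SignalAssumption S P X L) (t : ℕ) :
    MemLp (fun q : I × Ω => X t q.1 q.2) 2 ((volume : Measure I).prod P) := by
  obtain ⟨C, hC0, hC⟩ := h.second_moment_le
  refine ⟨(h.measurable t).aestronglyMeasurable, ?_⟩
  have h1 := eLpNorm_nnreal_pow_eq_lintegral (f := fun q : I × Ω => X t q.1 q.2)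
    (μ := (volume : Measure I).prod P) (p := 2) two_ne_zero
  have h2 : ∫⁻ q : I × Ω, ‖X t q.1 q.2‖ₑ ^ 2 ∂((volume : Measure I).prod P) ≤
      ENNReal.ofReal C := by
    rw [lintegral_prod _ ((h.measurable t).enorm.pow_const 2).aemeasurable]
    calc _ ≤ ∫⁻ _r : I, ENNReal.ofReal C := lintegral_mono fun r =>
          lintegral_enorm_pow_le even_two (h.memLp_two t r).integrable_sq (hC t r)
      _ = _ := by simp
  have h3 : eLpNorm (fun q : I × Ω => X t q.1 q.2) 2 ((volume : Measure I).prod P) ^ 2 < ⊤ := by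
    refine lt_of_le_of_lt ?_ (ENNReal.ofReal_lt_top (r := C))
    simpa using h1.le.trans (by simpa using h2)
  exact (ENNReal.pow_lt_top_iff.1 h3).resolve_right two_ne_zero

lemma integrable_mul_mul_prod [IsProbabilityMeasure P] {x : I × Ω → ℝ}
    (hx : MemLp x 2 ((volume : Measure I).prod P)) {f : I → ℝ} (hf : MemLp f 2 volume)
    {Y : Ω → ℝ} (hY : MemLp Y 2 P) :
    Integrable (fun q : I × Ω => x q * (f q.1 * Y q.2)) ((volume : Measure I).prod P) := by
  have h : MemLp (fun q : I × Ω => f q.1 * Y q.2) 2 ((volume : Measure I).prod P) := by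
    refine (memLp_two_iff_integrable_sq ?_).2 ?_
    · exact (hf.aestronglyMeasurable.comp_quasiMeasurePreserving Measure.quasiMeasurePreserving_fst).mul
        (hY.aestronglyMeasurable.comp_quasiMeasurePreserving Measure.quasiMeasurePreserving_snd)
    · simp_rw [mul_pow]
      exact hf.integrable_sq.mul_prod hY.integrable_sq
  exact hx.integrable_mul h

/-- Fubini's theorem for the scalar product of a random curve with a fixed function. -/
lemma integral_integral_mul_mul [IsProbabilityMeasure P] {x : I → Ω → ℝ}
    (hx : MemLp (fun q : I × Ω => x q.1 q.2) 2 ((volume : Measure I).prod P)) {f : I → ℝ}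
    (hf : MemLp f 2 volume) {Y : Ω → ℝ} (hY : MemLp Y 2 P) :
    ∫ ω, (∫ r, x r ω * f r) * Y ω ∂P = ∫ r, f r * ∫ ω, x r ω * Y ω ∂P := by
  have h := integrable_mul_mul_prod hx hf hY
  have h1 := integral_integral_swap (f := fun r ω => x r ω * (f r * Y ω)) h
  calc _ = ∫ ω, (∫ r, x r ω * (f r * Y ω)) ∂P := by
        refine integral_congr_ae (ae_of_all _ fun ω => ?_)
        simp only
        rw [← integral_mul_const]
        exact integral_congr_ae (ae_of_all _ fun r => by simp only; ring)
    _ = ∫ r, ∫ ω, x r ω * (f r * Y ω) ∂P := h1.symm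
    _ = _ := by
        refine integral_congr_ae (ae_of_all _ fun r => ?_)
        simp only
        rw [← integral_const_mul]
        exact integral_congr_ae (ae_of_all _ fun ω => by simp only; ring)

lemma inner_L2I_eq {x : I → ℝ} {z : L2I} (hz : x =ᵐ[volume] z) (f : L2I) :
    ⟪z, f⟫ = ∫ r, x r * f r := by
  rw [L2.inner_def]
  refine integral_congr_ae ?_
  filter_upwards [hz] with r hr
  rw [hr]
  simp [mul_comm]

/-- The covariance form of a random element of `L²` in terms of the covariance kernel. -/
lemma SignalAssumption.integral_inner_mul_inner [IsProbabilityMeasure P]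
    (h : SignalAssumption S P X L) {Z : Ω → L2I}
    (hZ : ∀ᵐ ω ∂P, (fun s => X 0 s ω) =ᵐ[volume] (Z ω : I → ℝ)) (hZ2 : MemLp Z 2 P) (f f' : L2I) :
    ∫ ω, ⟪Z ω, f⟫ * ⟪Z ω, f'⟫ ∂P = ∫ r, f r * ∫ v, cov[X 0 r, X 0 v; P] * f' v := by
  have hY : MemLp (fun ω => ⟪Z ω, f'⟫) 2 P := hZ2.inner_const f'
  have h1 : ∫ ω, ⟪Z ω, f⟫ * ⟪Z ω, f'⟫ ∂P = ∫ ω, (∫ r, X 0 r ω * f r) * ⟪Z ω, f'⟫ ∂P := by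
    refine integral_congr_ae ?_
    filter_upwards [hZ] with ω hω
    rw [inner_L2I_eq hω f]
  rw [h1, integral_integral_mul_mul (h.memLp_prod 0) (Lp.memLp f) hY]
  refine integral_congr_ae (ae_of_all _ fun r => ?_)
  simp only
  congr 1
  have h2 : ∫ ω, X 0 r ω * ⟪Z ω, f'⟫ ∂P = ∫ ω, (∫ v, X 0 v ω * f' v) * X 0 r ω ∂P := by
    refine integral_congr_ae ?_
    filter_upwards [hZ] with ω hω
    rw [inner_L2I_eq hω f', mul_comm]
  rw [h2, integral_integral_mul_mul (h.memLp_prod 0) (Lp.memLp f') (h.memLp_two 0 r)]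
  refine integral_congr_ae (ae_of_all _ fun v => ?_)
  simp only
  rw [covariance_eq_sub (h.memLp_two 0 r) (h.memLp_two 0 v), h.mean_zero, h.mean_zero]
  simp only [Pi.mul_apply, mul_zero, sub_zero]
  rw [mul_comm]
  congr 1
  exact integral_congr_ae (ae_of_all _ fun ω => mul_comm _ _)

/-- The curves have a fourth moment in `L²`. -/
lemma SignalAssumption.memLp_four_curve [IsProbabilityMeasure P] (h : SignalAssumption S P X L)
    {t : ℕ} {Z : Ω → L2I} (hZ : ∀ᵐ ω ∂P, (fun s => X t s ω) =ᵐ[volume] (Z ω : I → ℝ))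
    (hZm : AEStronglyMeasurable Z P) : MemLp Z 4 P := by
  obtain ⟨C, hC0, hC⟩ := h.fourth_moment_le
  refine ⟨hZm, ?_⟩
  have h1 := eLpNorm_nnreal_pow_eq_lintegral (f := Z) (μ := P) (p := 4) four_ne_zero
  have h2 : ∫⁻ ω, ‖Z ω‖ₑ ^ 4 ∂P ≤ ENNReal.ofReal C := by
    calc ∫⁻ ω, ‖Z ω‖ₑ ^ 4 ∂P ≤ ∫⁻ ω, ∫⁻ r : I, ‖X t r ω‖ₑ ^ 4 ∂volume ∂P := by
          refine lintegral_mono_ae ?_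
          filter_upwards [hZ] with ω hω
          -- On a probability space the L² norm is at most the L⁴ norm; Tonelli then reduces to
          -- pointwise fourth moments.
          have h3 : ‖Z ω‖ₑ ≤ eLpNorm (fun r => X t r ω) 4 volume := by
            rw [Lp.enorm_def, ← eLpNorm_congr_ae hω]
            refine eLpNorm_le_eLpNorm_of_exponent_le (by norm_num) ?_
            exact ((h.measurable t).comp (measurable_id.prodMk measurable_const)).aestronglyMeasurable
          have h4 := eLpNorm_nnreal_pow_eq_lintegral (f := fun r => X t r ω)
            (μ := (volume : Measure I)) (p := 4) four_ne_zero
          calc _ ≤ eLpNorm (fun r => X t r ω) 4 volume ^ 4 := by gcongr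
            _ = _ := by simpa using h4
      _ = ∫⁻ r : I, ∫⁻ ω, ‖X t r ω‖ₑ ^ 4 ∂P := by
          refine (lintegral_lintegral_swap ?_).symm
          exact ((h.measurable t).enorm.pow_const 4).aemeasurable
      _ ≤ ∫⁻ _r : I, ENNReal.ofReal C := lintegral_mono fun r =>
          lintegral_enorm_pow_le (by decide) (integrable_pow_four (h.memLp_four t r)) (hC t r)
      _ = _ := by simp
  have h3 : eLpNorm Z 4 P ^ 4 < ⊤ := by
    refine lt_of_le_of_lt ?_ (ENNReal.ofReal_lt_top (r := C))
    simpa using h1.le.trans (by simpa using h2)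
  exact (ENNReal.pow_lt_top_iff.1 h3).resolve_right four_ne_zero

lemma aestronglyMeasurable_stepL2 {n : ℕ} {y : Fin n → Ω → ℝ}
    (hy : ∀ i, AEStronglyMeasurable (y i) P) :
    AEStronglyMeasurable (fun ω => stepL2 fun i => y i ω) P := by
  unfold stepL2
  refine Finset.aestronglyMeasurable_fun_sum _ fun i _ => ?_
  exact ((hy i).mul_const _).smul_const _

/-- The discretisation error in mean square. -/
lemma SignalAssumption.integral_norm_stepL2_sub_le [IsProbabilityMeasure P]
    (h : SignalAssumption S P X L) {t : ℕ} {Z : Ω → L2I}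
    (hZ : ∀ᵐ ω ∂P, (fun s => X t s ω) =ᵐ[volume] (Z ω : I → ℝ))
    (hZm : AEStronglyMeasurable Z P) {C η : ℝ} (hC0 : 0 ≤ C)
    (hC : ∀ s s' : I, |(s' : ℝ) - s| ≤ η →
      ∫ ω, (X t s' ω - X t s ω) ^ 2 ∂P ≤ C * |(s' : ℝ) - s|)
    {n : ℕ} (hn : 2 ≤ n) (hnη : 3 / (n : ℝ) ≤ η) {s : Fin n → I} (hs : IsEquidistant s) :
    Integrable (fun ω => ‖stepL2 (fun i => X t (s i) ω) - Z ω‖ ^ 2) P ∧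
      ∫ ω, ‖stepL2 (fun i => X t (s i) ω) - Z ω‖ ^ 2 ∂P ≤ C * (3 / n) := by
  have hn0 : 0 < n := by omega
  have hm : AEStronglyMeasurable (fun ω => stepL2 (fun i => X t (s i) ω) - Z ω) P :=
    (aestronglyMeasurable_stepL2 fun i => (h.memLp_two t (s i)).aestronglyMeasurable).sub hZm
  have hσ := measurable_sampleMap hn0 s
  have hmeas : Measurable fun q : I × Ω => X t (sampleMap hn0 s q.1) q.2 - X t q.1 q.2 :=
    ((h.measurable t).comp ((hσ.comp measurable_fst).prodMk measurable_snd)).sub (h.measurable t)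
  have hpt : ∀ᵐ ω ∂P, ‖stepL2 (fun i => X t (s i) ω) - Z ω‖ₑ ^ 2 =
      ∫⁻ r : I, ‖X t (sampleMap hn0 s r) ω - X t r ω‖ₑ ^ 2 := by
    filter_upwards [hZ] with ω hω
    exact enorm_stepL2_sub_sq hn0 s (x := fun r => X t r ω) hω
  have hbound : ∫⁻ ω, ‖stepL2 (fun i => X t (s i) ω) - Z ω‖ₑ ^ 2 ∂P ≤
      ENNReal.ofReal (C * (3 / n)) := by
    calc _ = ∫⁻ ω, ∫⁻ r : I, ‖X t (sampleMap hn0 s r) ω - X t r ω‖ₑ ^ 2 ∂volume ∂P := by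
          exact lintegral_congr_ae hpt
      _ = ∫⁻ r : I, ∫⁻ ω, ‖X t (sampleMap hn0 s r) ω - X t r ω‖ₑ ^ 2 ∂P := by
          refine (lintegral_lintegral_swap ?_).symm
          exact (hmeas.enorm.pow_const 2).aemeasurable
      _ ≤ ∫⁻ _r : I, ENNReal.ofReal (C * (3 / n)) := by
          refine lintegral_mono_ae ?_
          filter_upwards [Measure.ae_ne (volume : Measure I) 1] with r hr
          have h1 := abs_sampleMap_sub_le hn hs hr
          refine lintegral_enorm_pow_le even_two ?_ ?_
          · exact ((h.memLp_two t _).sub (h.memLp_two t r)).integrable_sq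
          · refine (hC _ _ (h1.trans hnη)).trans ?_
            gcongr
      _ = _ := by simp
  have heq : ∀ ω, ‖stepL2 (fun i => X t (s i) ω) - Z ω‖ₑ ^ 2 =
      ENNReal.ofReal (‖stepL2 (fun i => X t (s i) ω) - Z ω‖ ^ 2) := fun ω => by
    rw [ENNReal.ofReal_pow (norm_nonneg _), ofReal_norm]
  simp_rw [heq] at hbound
  have hint : Integrable (fun ω => ‖stepL2 (fun i => X t (s i) ω) - Z ω‖ ^ 2) P := by
    refine ⟨hm.norm.pow 2, ?_⟩
    rw [hasFiniteIntegral_iff_ofReal (ae_of_all _ fun ω => sq_nonneg _)]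
    exact hbound.trans_lt ENNReal.ofReal_lt_top
  refine ⟨hint, ?_⟩
  rw [← ofReal_integral_eq_lintegral_ofReal hint (ae_of_all _ fun ω => sq_nonneg _)] at hbound
  exact (ENNReal.ofReal_le_ofReal_iff (by positivity)).1 hbound

end SignalCurves

/-! ### Pathwise decomposition of the empirical covariance form. -/

section Deterministic

lemma sum_sum_sum_comm {τ ι κ : Type*} [Fintype τ] [Fintype ι] [Fintype κ] (F : τ → ι → κ → ℝ) :
    ∑ t, ∑ i, ∑ j, F t i j = ∑ i, ∑ j, ∑ t, F t i j := by
  rw [Finset.sum_comm]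
  exact Finset.sum_congr rfl fun i _ => Finset.sum_comm

/-- Rewrites the cross and noise forms in cell coordinates, where Frobenius norms of matrices bound
them. -/
lemma sum_sum_mul_inner_cellBasis {T n : ℕ} (x u : Fin T → Fin n → ℝ) (f : L2I) :
    ∑ i, ∑ j, (((n : ℝ) * T)⁻¹ * ∑ t, x t i * u t j) *
      (⟪cellBasis n i, f⟫ * ⟪cellBasis n j, f⟫) =
    (T : ℝ)⁻¹ * ∑ t, ⟪stepL2 (x t), f⟫ * ⟪stepL2 (u t), f⟫ := by
  have h : ∀ t, ⟪stepL2 (x t), f⟫ * ⟪stepL2 (u t), f⟫ = ∑ i, ∑ j,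
      (n : ℝ)⁻¹ * (x t i * u t j) * (⟪cellBasis n i, f⟫ * ⟪cellBasis n j, f⟫) := fun t => by
    rw [inner_stepL2, inner_stepL2, Finset.sum_mul_sum]
    refine Finset.sum_congr rfl fun i _ => Finset.sum_congr rfl fun j _ => ?_
    have hn : (0 : ℝ) < n := by exact_mod_cast (Nat.zero_le _).trans_lt i.2
    have hs : (n : ℝ)⁻¹ = (√(n : ℝ))⁻¹ * (√(n : ℝ))⁻¹ := by
      rw [← mul_inv, Real.mul_self_sqrt hn.le]
    rw [hs]
    ring
  simp_rw [h]
  rw [sum_sum_sum_comm, Finset.mul_sum]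
  refine Finset.sum_congr rfl fun i _ => ?_
  rw [Finset.mul_sum]
  refine Finset.sum_congr rfl fun j _ => ?_
  rw [mul_inv, Finset.mul_sum, Finset.sum_mul, Finset.mul_sum]
  exact Finset.sum_congr rfl fun t _ => by ring

lemma sum_inner_sq_le {ι : Type*} [Fintype ι] {e : ι → L2I} (he : Orthonormal ℝ e) (f : L2I) :
    ∑ k, ⟪e k, f⟫ ^ 2 ≤ ‖f‖ ^ 2 := by
  simpa using he.sum_inner_products_le f (s := Finset.univ)

/-- Distance between the quadratic forms of the empirical and the limiting covariance. -/
lemma abs_sum_inner_sq_sub_le {T n L : ℕ} (hT : 0 < T) (hn : 0 < n) (Z : Fin T → L2I)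
    (x u : Fin T → Fin n → ℝ) {e : Fin L → L2I} (he : Orthonormal ℝ e)
    (hZ : ∀ t f, ⟪Z t, f⟫ = ∑ k, ⟪e k, Z t⟫ * ⟪e k, f⟫) (μ : Fin L → Fin L → ℝ) (f : L2I) :
    |(T : ℝ)⁻¹ * ∑ t, ⟪stepL2 (fun i => x t i + u t i), f⟫ ^ 2 -
        ∑ k, ∑ l, μ k l * (⟪e k, f⟫ * ⟪e l, f⟫)| ≤
      (√(∑ k, ∑ l, ((T : ℝ)⁻¹ * ∑ t, (coordMul (e k) (e l) (Z t) - μ k l)) ^ 2) +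
        (T : ℝ)⁻¹ * ∑ t, ((√(n : ℝ))⁻¹ * ‖Z t‖ ^ 2 + (√(n : ℝ) + 1) * ‖stepL2 (x t) - Z t‖ ^ 2) +
        (√(∑ i, ∑ j, (((n : ℝ) * T)⁻¹ * ∑ t, x t i * u t j) ^ 2) +
          √(∑ i, ∑ j, (((n : ℝ) * T)⁻¹ * ∑ t, x t i * u t j) ^ 2)) +
        √(∑ i, ∑ j, (((n : ℝ) * T)⁻¹ * ∑ t, u t i * u t j) ^ 2)) * ‖f‖ ^ 2 := by
  have hT' : (0 : ℝ) < T := by exact_mod_cast hT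
  have hn' : (0 : ℝ) < √(n : ℝ) := Real.sqrt_pos.2 (by exact_mod_cast hn)
  have hA1 : ∑ k, ∑ l, ((T : ℝ)⁻¹ * ∑ t, (coordMul (e k) (e l) (Z t) - μ k l)) *
      (⟪e k, f⟫ * ⟪e l, f⟫) = (T : ℝ)⁻¹ * ∑ t, ⟪Z t, f⟫ ^ 2 -
        ∑ k, ∑ l, μ k l * (⟪e k, f⟫ * ⟪e l, f⟫) := by
    have h : ∀ t, ⟪Z t, f⟫ ^ 2 =
        ∑ k, ∑ l, coordMul (e k) (e l) (Z t) * (⟪e k, f⟫ * ⟪e l, f⟫) := fun t => by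
      rw [hZ t f, sq, Finset.sum_mul_sum]
      exact Finset.sum_congr rfl fun k _ => Finset.sum_congr rfl fun l _ => by
        rw [coordMul]; ring
    simp_rw [h]
    rw [sum_sum_sum_comm, Finset.mul_sum, ← Finset.sum_sub_distrib]
    refine Finset.sum_congr rfl fun k _ => ?_
    rw [Finset.mul_sum, ← Finset.sum_sub_distrib]
    refine Finset.sum_congr rfl fun l _ => ?_
    rw [Finset.sum_sub_distrib, Finset.sum_const, Finset.card_univ, Fintype.card_fin,
      nsmul_eq_mul, ← Finset.sum_mul]
    field_simp
  have hA3 := sum_sum_mul_inner_cellBasis x u f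
  have hA4 := sum_sum_mul_inner_cellBasis u u f
  have hid : (T : ℝ)⁻¹ * ∑ t, ⟪stepL2 (fun i => x t i + u t i), f⟫ ^ 2 =
      (T : ℝ)⁻¹ * ∑ t, ⟪Z t, f⟫ ^ 2 +
      (T : ℝ)⁻¹ * ∑ t, (2 * ⟪Z t, f⟫ * ⟪stepL2 (x t) - Z t, f⟫ + ⟪stepL2 (x t) - Z t, f⟫ ^ 2) +
      ((T : ℝ)⁻¹ * ∑ t, ⟪stepL2 (x t), f⟫ * ⟪stepL2 (u t), f⟫ +
        (T : ℝ)⁻¹ * ∑ t, ⟪stepL2 (x t), f⟫ * ⟪stepL2 (u t), f⟫) +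
      (T : ℝ)⁻¹ * ∑ t, ⟪stepL2 (u t), f⟫ * ⟪stepL2 (u t), f⟫ := by
    simp only [← mul_add, ← Finset.sum_add_distrib]
    congr 1
    refine Finset.sum_congr rfl fun t _ => ?_
    rw [stepL2_add, inner_add_left, inner_sub_left]
    ring
  have hB1 := abs_sum_sum_mul_le
    (fun k l => (T : ℝ)⁻¹ * ∑ t, (coordMul (e k) (e l) (Z t) - μ k l))
    (fun k => ⟪e k, f⟫) (fun l => ⟪e l, f⟫) (sum_inner_sq_le he f) (sum_inner_sq_le he f)
  have hb := sum_inner_sq_le (orthonormal_cellBasis n) f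
  have hB3 := abs_sum_sum_mul_le (fun i j => ((n : ℝ) * T)⁻¹ * ∑ t, x t i * u t j)
    (fun i => ⟪cellBasis n i, f⟫) (fun j => ⟪cellBasis n j, f⟫) hb hb
  have hB4 := abs_sum_sum_mul_le (fun i j => ((n : ℝ) * T)⁻¹ * ∑ t, u t i * u t j)
    (fun i => ⟪cellBasis n i, f⟫) (fun j => ⟪cellBasis n j, f⟫) hb hb
  have hB2 : |(T : ℝ)⁻¹ * ∑ t, (2 * ⟪Z t, f⟫ * ⟪stepL2 (x t) - Z t, f⟫ +
      ⟪stepL2 (x t) - Z t, f⟫ ^ 2)| ≤ (T : ℝ)⁻¹ * ∑ t, ((√(n : ℝ))⁻¹ * ‖Z t‖ ^ 2 +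
        (√(n : ℝ) + 1) * ‖stepL2 (x t) - Z t‖ ^ 2) * ‖f‖ ^ 2 := by
    rw [abs_mul, abs_of_pos (inv_pos.2 hT')]
    refine mul_le_mul_of_nonneg_left ?_ (inv_pos.2 hT').le
    refine (Finset.abs_sum_le_sum_abs _ _).trans (Finset.sum_le_sum fun t _ => ?_)
    have h1 : ⟪Z t, f⟫ ^ 2 ≤ ‖Z t‖ ^ 2 * ‖f‖ ^ 2 := by
      rw [← mul_pow, sq_le_sq, abs_of_nonneg (show 0 ≤ ‖Z t‖ * ‖f‖ by positivity)]
      exact abs_real_inner_le_norm _ _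
    have h2 : ⟪stepL2 (x t) - Z t, f⟫ ^ 2 ≤ ‖stepL2 (x t) - Z t‖ ^ 2 * ‖f‖ ^ 2 := by
      rw [← mul_pow, sq_le_sq, abs_of_nonneg (show 0 ≤ ‖stepL2 (x t) - Z t‖ * ‖f‖ by positivity)]
      exact abs_real_inner_le_norm _ _
    set α := ⟪Z t, f⟫
    set ρ := ⟪stepL2 (x t) - Z t, f⟫
    set s := √(n : ℝ)
    -- Weighted AM-GM with weight √n: as ρ² has mean of order 1/n, both terms end up of order 1/√n.
    have h3 : |2 * α * ρ| ≤ s⁻¹ * α ^ 2 + s * ρ ^ 2 := by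
      have h4 : s⁻¹ * α ^ 2 + s * ρ ^ 2 - 2 * α * ρ = s⁻¹ * (α - s * ρ) ^ 2 := by
        field_simp; ring
      have h5 : s⁻¹ * α ^ 2 + s * ρ ^ 2 + 2 * α * ρ = s⁻¹ * (α + s * ρ) ^ 2 := by
        field_simp; ring
      have h6 : 0 ≤ s⁻¹ * (α - s * ρ) ^ 2 := by positivity
      have h7 : 0 ≤ s⁻¹ * (α + s * ρ) ^ 2 := by positivity
      rw [abs_le]
      constructor <;> linarith
    calc |2 * α * ρ + ρ ^ 2| ≤ |2 * α * ρ| + |ρ ^ 2| := abs_add_le _ _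
      _ ≤ (s⁻¹ * α ^ 2 + s * ρ ^ 2) + ρ ^ 2 := by
          rw [abs_of_nonneg (sq_nonneg ρ)]; gcongr
      _ = s⁻¹ * α ^ 2 + (s + 1) * ρ ^ 2 := by ring
      _ ≤ s⁻¹ * (‖Z t‖ ^ 2 * ‖f‖ ^ 2) + (s + 1) * (‖stepL2 (x t) - Z t‖ ^ 2 * ‖f‖ ^ 2) := by
          gcongr
      _ = _ := by ring
  rw [← Finset.sum_mul, ← mul_assoc] at hB2
  rw [hid]
  rw [hA1] at hB1
  rw [hA3] at hB3
  rw [hA4] at hB4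
  rw [abs_le] at *
  constructor <;> linarith [hB1.1, hB1.2, hB2.1, hB2.2, hB3.1, hB3.2, hB4.1, hB4.2]

end Deterministic

/-! ### The covariance form and its eigenfunctions. -/

section Eigensystem

/-- An orthonormal basis of a finite-dimensional subspace. -/
lemma exists_orthonormal_expansion {V : Submodule ℝ L2I} {L : ℕ} (hL : 1 ≤ L)
    (hV : Module.finrank ℝ V = L) :
    ∃ e : Fin L → L2I, Orthonormal ℝ e ∧
      ∀ z ∈ V, ∀ f, ⟪z, f⟫ = ∑ k, ⟪e k, z⟫ * ⟪e k, f⟫ := by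
  subst hV
  -- `finrank` is 0 in infinite dimension, so L ≥ 1 is what yields finite dimension.
  have : FiniteDimensional ℝ V := Module.finite_of_finrank_pos hL
  let b := stdOrthonormalBasis ℝ V
  refine ⟨fun k => b k, b.orthonormal.comp_linearIsometry V.subtypeₗᵢ, fun z hz f => ?_⟩
  have h := congrArg (Subtype.val) (b.sum_repr' ⟨z, hz⟩)
  simp only [Submodule.coe_sum, Submodule.coe_smul, Submodule.coe_inner] at h
  conv_lhs => rw [← h]
  simp [sum_inner, inner_smul_left]

/-- The bilinear form with matrix `μ` in the system `e`. -/
noncomputable def matrixForm {L : ℕ} (e : Fin L → L2I) (μ : Fin L → Fin L → ℝ) :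
    L2I →L[ℝ] L2I →L[ℝ] ℝ :=
  ∑ k, ∑ l, μ k l • (innerSL ℝ (e k)).smulRight (innerSL ℝ (e l))

lemma matrixForm_apply {L : ℕ} (e : Fin L → L2I) (μ : Fin L → Fin L → ℝ) (f f' : L2I) :
    matrixForm e μ f f' = ∑ k, ∑ l, μ k l * (⟪e k, f⟫ * ⟪e l, f'⟫) := by
  simp [matrixForm]

variable {Ω : Type*} [MeasurableSpace Ω] {P : Measure Ω} [IsProbabilityMeasure P]

/-- Almost surely Z lies in the span of e, so its L × L moments determine the covariance form, which
thereby becomes a continuous bilinear form. -/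
lemma matrixForm_eq_integral {L : ℕ} {e : Fin L → L2I} {Z : Ω → L2I} (hZ4 : MemLp Z 4 P)
    (hZ : ∀ᵐ ω ∂P, ∀ f, ⟪Z ω, f⟫ = ∑ k, ⟪e k, Z ω⟫ * ⟪e k, f⟫) (f f' : L2I) :
    matrixForm e (fun k l => ∫ ω, coordMul (e k) (e l) (Z ω) ∂P) f f' =
      ∫ ω, ⟪Z ω, f⟫ * ⟪Z ω, f'⟫ ∂P := by
  have h : ∫ ω, ⟪Z ω, f⟫ * ⟪Z ω, f'⟫ ∂P =
      ∫ ω, ∑ k, ∑ l, coordMul (e k) (e l) (Z ω) * (⟪e k, f⟫ * ⟪e l, f'⟫) ∂P := by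
    refine integral_congr_ae ?_
    filter_upwards [hZ] with ω hω
    rw [hω f, hω f', Finset.sum_mul_sum]
    exact Finset.sum_congr rfl fun k _ => Finset.sum_congr rfl fun l _ => by
      rw [coordMul]; ring
  have hI : ∀ k l, Integrable (fun ω => coordMul (e k) (e l) (Z ω) * (⟪e k, f⟫ * ⟪e l, f'⟫)) P :=
    fun k l => ((memLp_coordMul hZ4 (e k) (e l)).integrable one_le_two).mul_const _
  rw [h, matrixForm_apply, integral_finsetSum _ fun k _ => integrable_finsetSum _ fun l _ => hI k l]
  refine Finset.sum_congr rfl fun k _ => ?_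
  rw [integral_finsetSum _ fun l _ => hI k l]
  exact Finset.sum_congr rfl fun l _ => (integral_mul_const _ _).symm

/-- The eigenfunctions as elements of `L²`. -/
noncomputable def IsEigensystem.toL2 {K : I → I → ℝ} {lam : ℕ → ℝ} {φ : ℕ → I → ℝ}
    (h : IsEigensystem K lam φ) (i : ℕ) : L2I := (h.memLp i).toLp (φ i)

lemma IsEigensystem.inner_toL2 {K : I → I → ℝ} {lam : ℕ → ℝ} {φ : ℕ → I → ℝ}
    (h : IsEigensystem K lam φ) (i : ℕ) (f : L2I) : ⟪h.toL2 i, f⟫ = ∫ r, φ i r * f r :=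
  inner_L2I_eq (h.memLp i).coeFn_toLp.symm f

lemma IsEigensystem.orthonormal_toL2 {K : I → I → ℝ} {lam : ℕ → ℝ} {φ : ℕ → I → ℝ}
    (h : IsEigensystem K lam φ) : Orthonormal ℝ h.toL2 := by
  rw [orthonormal_iff_ite]
  intro i j
  rw [h.inner_toL2, ← h.orthonormal i j]
  refine integral_congr_ae ?_
  filter_upwards [(h.memLp j).coeFn_toLp] with r hr
  rw [IsEigensystem.toL2, hr]

variable {S : Type*} [MeasurableSpace S] {X : ℕ → I → Ω → ℝ} {L : ℕ} {lam : ℕ → ℝ}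
  {φ : ℕ → I → ℝ}

lemma SignalAssumption.integral_inner_mul_toL2 (h : SignalAssumption S P X L)
    (hE : IsEigensystem (fun r v => cov[X 0 r, X 0 v; P]) lam φ) {Z : Ω → L2I}
    (hZ : ∀ᵐ ω ∂P, (fun s => X 0 s ω) =ᵐ[volume] (Z ω : I → ℝ)) (hZ2 : MemLp Z 2 P)
    (i : ℕ) (f : L2I) :
    ∫ ω, ⟪Z ω, f⟫ * ⟪Z ω, hE.toL2 i⟫ ∂P = lam i * ⟪f, hE.toL2 i⟫ := by
  rw [h.integral_inner_mul_inner hZ hZ2, real_inner_comm, hE.inner_toL2, ← integral_const_mul]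
  refine integral_congr_ae (ae_of_all _ fun r => ?_)
  have h1 : ∫ v, cov[X 0 r, X 0 v; P] * hE.toL2 i v = ∫ v, cov[X 0 r, X 0 v; P] * φ i v := by
    refine integral_congr_ae ?_
    filter_upwards [(hE.memLp i).coeFn_toLp] with v hv
    rw [IsEigensystem.toL2, hv]
  simp only [h1, hE.eigen i r]
  ring

lemma SignalAssumption.integral_inner_mul_eq_zero (h : SignalAssumption S P X L)
    (hE : IsEigensystem (fun r v => cov[X 0 r, X 0 v; P]) lam φ) {Z : Ω → L2I}
    (hZ : ∀ᵐ ω ∂P, (fun s => X 0 s ω) =ᵐ[volume] (Z ω : I → ℝ)) (hZ2 : MemLp Z 2 P)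
    {w : L2I} (hw : ∀ i, ⟪hE.toL2 i, w⟫ = 0) (f : L2I) :
    ∫ ω, ⟪Z ω, f⟫ * ⟪Z ω, w⟫ ∂P = 0 := by
  rw [h.integral_inner_mul_inner hZ hZ2]
  have h1 := hE.complete w (Lp.memLp w) fun i => by rw [← hE.inner_toL2, hw]
  simp [h1]

/-- Comparison of the eigenvalues of the kernel operator and of the Gram matrix. -/
lemma SignalAssumption.abs_sub_gammaHat_le (h : SignalAssumption S P X L)
    (hE : IsEigensystem (fun r v => cov[X 0 r, X 0 v; P]) lam φ) {Z : Ω → L2I}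
    (hZ : ∀ᵐ ω ∂P, (fun s => X 0 s ω) =ᵐ[volume] (Z ω : I → ℝ)) (hZ4 : MemLp Z 4 P)
    {e : Fin L → L2I} (he : ∀ᵐ ω ∂P, ∀ f, ⟪Z ω, f⟫ = ∑ k, ⟪e k, Z ω⟫ * ⟪e k, f⟫)
    {n T : ℕ} (hn : 0 < n) (Y : Matrix (Fin n) (Fin T) ℝ) {ε : ℝ}
    (hε : ∀ f, |(T : ℝ)⁻¹ * ∑ t, ⟪stepL2 (fun i => Y i t), f⟫ ^ 2 -
      ∑ k, ∑ l, (∫ ω, coordMul (e k) (e l) (Z ω) ∂P) * (⟪e k, f⟫ * ⟪e l, f⟫)| ≤ ε * ‖f‖ ^ 2)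
    (i : ℕ) : |lam i - gammaHat Y i / n| ≤ ε := by
  have hn' : (0 : ℝ) < n := by exact_mod_cast hn
  have hZ2 : MemLp Z 2 P := hZ4.mono_exponent (by norm_num)
  set Q := matrixForm e (fun k l => ∫ ω, coordMul (e k) (e l) (Z ω) ∂P) with hQ
  have hQi : ∀ f f', Q f f' = ∫ ω, ⟪Z ω, f⟫ * ⟪Z ω, f'⟫ ∂P := matrixForm_eq_integral hZ4 he
  have hsymm : ∀ f f', Q f f' = Q f' f := fun f f' => by
    rw [hQi, hQi]
    exact integral_congr_ae (ae_of_all _ fun ω => mul_comm _ _)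
  have hQφ : ∀ i f, Q f (hE.toL2 i) = lam i * ⟪f, hE.toL2 i⟫ := fun i f => by
    rw [hQi, h.integral_inner_mul_toL2 hE hZ hZ2]
  have hQ0 : ∀ w, (∀ i, ⟪hE.toL2 i, w⟫ = 0) → ∀ f, Q f w = 0 := fun w hw f => by
    rw [hQi, h.integral_inner_mul_eq_zero hE hZ hZ2 hw]
  -- With the factor √(n/T), the step functions have Gram matrix exactly `gram Y`. Everything is
  -- scaled by n here and divided by n at the end.
  have key := abs_sub_eigenvalueSeq_le
    (fun t => √((n : ℝ) / T) • stepL2 (fun i => Y i t)) (gram_isHermitian Y) (fun t t' => by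
      have hT : (0 : ℝ) < T := by exact_mod_cast (Nat.zero_le _).trans_lt t.2
      rw [inner_smul_left, inner_smul_right, inner_stepL2_stepL2, conj_trivial, ← mul_assoc,
        Real.mul_self_sqrt (by positivity), ← mul_assoc]
      have : (n : ℝ) / T * (n : ℝ)⁻¹ = (T : ℝ)⁻¹ := by field_simp
      rw [this]
      simp [gram, Matrix.mul_apply])
    (lam := fun i => n * lam i) (fun i => mul_nonneg hn'.le (hE.nonneg i)) hE.orthonormal_toL2
    (q := fun f => n * Q f f)
    (fun i b => by
      rw [mul_assoc]
      exact mul_le_mul_of_nonneg_left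
        (eigenvalue_mul_norm_sq_le hE.antitone hE.orthonormal_toL2 Q hQφ i b) hn'.le)
    (fun i f hf => by
      rw [mul_assoc]
      exact mul_le_mul_of_nonneg_left (le_eigenvalue_mul_norm_sq hE.antitone hE.nonneg
        hE.orthonormal_toL2 Q hsymm hQφ hQ0 i f hf) hn'.le)
    (ε := n * ε) (fun f => by
      have h1 : ∑ t : Fin T, ⟪√((n : ℝ) / T) • stepL2 (fun i => Y i t), f⟫ ^ 2 - n * Q f f =
          n * ((T : ℝ)⁻¹ * ∑ t, ⟪stepL2 (fun i => Y i t), f⟫ ^ 2 - ∑ k, ∑ l,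
            (∫ ω, coordMul (e k) (e l) (Z ω) ∂P) * (⟪e k, f⟫ * ⟪e l, f⟫)) := by
        rw [hQ, matrixForm_apply, mul_sub, ← mul_assoc]
        congr 1
        rw [Finset.mul_sum]
        refine Finset.sum_congr rfl fun t _ => ?_
        rw [inner_smul_left, conj_trivial, mul_pow, Real.sq_sqrt (by positivity), div_eq_mul_inv]
      rw [h1, abs_mul, abs_of_pos hn', mul_assoc]
      exact mul_le_mul_of_nonneg_left (hε f) hn'.le) i
  have h2 : n * lam i - eigenvalueSeq (gram_isHermitian Y) i = n * (lam i - gammaHat Y i / n) := by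
    rw [mul_sub, mul_div_cancel₀ _ hn'.ne']
    rfl
  rw [h2, abs_mul, abs_of_pos hn'] at key
  exact le_of_mul_le_mul_left key hn'

end Eigensystem

/-! ### Rates of the four error terms. -/

section Main

variable {Ω : Type*} [MeasurableSpace Ω] {P : Measure Ω} {S : Type*}
  [MeasurableSpace S] {X : ℕ → I → Ω → ℝ} {p : ℕ → ℕ} {s : (T : ℕ) → Fin (p T) → I}
  {u : (T : ℕ) → Fin T → Fin (p T) → Ω → ℝ} {γ : ℤ → ℝ} {L : ℕ} {lam : ℕ → ℝ} {φ : ℕ → I → ℝ}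

lemma isBigOP_sqrt_of_integral_le {Q : ℕ → Ω → ℝ} {r r' : ℕ → ℝ} {C : ℝ}
    (hQ0 : ∀ T ω, 0 ≤ Q T ω) (hQ : ∀ T, Integrable (Q T) P) (hr0 : ∀ T, 0 ≤ r T)
    (hr' : ∀ᶠ T in atTop, 0 < r' T ∧ r' T ≤ r T ^ 2)
    (h : ∀ᶠ T in atTop, ∫ ω, Q T ω ∂P ≤ C * r' T) : IsBigOP P (fun T ω => √(Q T ω)) r := by
  refine IsBigOP.sqrt ?_ hr0
  refine IsBigOP.mono_rate (r := r') ?_ (hr'.mono fun T hT => ⟨hT.1.le, hT.2⟩)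
  exact isBigOP_of_integral_le (.of_forall hQ0) (.of_forall hQ) (hr'.mono fun T hT => hT.1) h

/-- The representation of the curves as random elements of `L²`. -/
lemma SignalAssumption.exists_past (h : SignalAssumption S P X L) :
    ∃ (δ : ℤ → Ω → S) (g : (ℕ → S) → L2I), (∀ t, Measurable (δ t)) ∧ iIndepFun δ P ∧
      (∀ t, IdentDistrib (δ t) (δ 0) P P) ∧ StronglyMeasurable g ∧
      (∀ t : ℕ, ∀ᵐ ω ∂P, (fun s => X t s ω) =ᵐ[volume] (g (past δ t ω) : I → ℝ)) ∧
      ∑' m, eLpNorm (fun w : Ω × Ω =>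
        g (past δ 0 w.1) - g (mix m (past δ 0 w.1) (past δ 0 w.2))) 4 (P.prod P) < ⊤ := by
  obtain ⟨Z, hZ, δ, g, hδ, hi, hid, hg, hZg, ha⟩ := h.approximable
  refine ⟨δ, g, hδ, hi, hid, hg, fun t => ?_, ?_⟩
  · filter_upwards [hZ t, hZg t] with ω h1 h2
    rw [h2] at h1
    exact h1
  · have h0 : ∀ ω, past δ 0 ω = fun k : ℕ => δ (-(k : ℤ)) ω := fun ω => by
      funext k
      simp [past]
    simp only [h0]
    exact ha

/-- The uniform eigenvalue error is bounded by a sequence of the required order. -/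
lemma exists_isBigOP_bound [IsProbabilityMeasure P] (hL : 1 ≤ L) (hNoise : NoiseAssumption P X p u γ)
    (hSignal : SignalAssumption S P X L)
    (hEig : IsEigensystem (fun r v => cov[X 0 r, X 0 v; P]) lam φ) (hp : Tendsto p atTop atTop)
    (hs : ∀ T, IsEquidistant (s T)) (hInc : IncrementCondition P (X 0)) :
    ∃ W : ℕ → Ω → ℝ, IsBigOP P W (fun T => 1 / √(p T) + 1 / √T) ∧
      ∀ᶠ T in atTop, ∀ᵐ ω ∂P, ∀ i, |lam i - gammaHat (dataMatrix X p s u T ω) i / p T| ≤ W T ω := by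
  obtain ⟨δ, g, hδ, hi, hid, hg, hXg, ha⟩ := hSignal.exists_past
  have hgm : ∀ t : ℕ, AEStronglyMeasurable (fun ω => g (past δ t ω)) P := fun t =>
    (hg.comp_measurable (measurable_past hδ t)).aestronglyMeasurable
  have hg4 : ∀ t : ℕ, MemLp (fun ω => g (past δ t ω)) 4 P := fun t =>
    hSignal.memLp_four_curve (hXg t) (hgm t)
  obtain ⟨V, hV, hXV⟩ := hSignal.finite_dim
  obtain ⟨e, he, heV⟩ := exists_orthonormal_expansion hL hV
  have hgV : ∀ t : ℕ, ∀ᵐ ω ∂P, ∀ f, ⟪g (past δ t ω), f⟫ =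
      ∑ k, ⟪e k, g (past δ t ω)⟫ * ⟪e k, f⟫ := fun t => by
    filter_upwards [hXg t, hXV t] with ω h1 h2 f
    obtain ⟨v, hv, hXv⟩ := h2
    have : g (past δ t ω) = v := Lp.ext (h1.symm.trans hXv)
    rw [this]
    exact heV v hv f
  set μ : Fin L → Fin L → ℝ := fun k l => ∫ ω, coordMul (e k) (e l) (g (past δ 0 ω)) ∂P with hμ
  set r : ℕ → ℝ := fun T => 1 / √(p T) + 1 / √T with hr
  have hr0 : ∀ T, 0 ≤ r T := fun T => by positivity
  have hev : ∀ᶠ T in atTop, 0 < T ∧ 2 ≤ p T :=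
    (eventually_gt_atTop 0).and (hp.eventually_ge_atTop 2)
  have hpos : ∀ᶠ T : ℕ in atTop, (0 : ℝ) < T ∧ (0 : ℝ) < p T := hev.mono fun T hT =>
    ⟨by exact_mod_cast hT.1, by exact_mod_cast (show 0 < p T by omega)⟩
  -- Dropping the mixed term of the square lets mean-square rates 1/p + 1/T pass to r after a square
  -- root.
  have hrsq : ∀ T, 1 / (p T : ℝ) + 1 / T ≤ r T ^ 2 := fun T => by
    have h1 : (1 / √(p T : ℝ)) ^ 2 = 1 / p T := by
      rw [div_pow, Real.sq_sqrt (by positivity), one_pow]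
    have h2 : (1 / √(T : ℝ)) ^ 2 = 1 / T := by
      rw [div_pow, Real.sq_sqrt (by positivity), one_pow]
    have h3 : 0 ≤ (1 / √(p T : ℝ)) * (1 / √(T : ℝ)) := by positivity
    simp only [hr, add_sq, h1, h2]
    linarith
  have hM : ∀ k l, ∃ C : ℝ, ∀ T : ℕ,
      Integrable (fun ω => (∑ t : Fin T, (coordMul (e k) (e l) (g (past δ (t : ℕ) ω)) - μ k l)) ^ 2)
        P ∧ ∫ ω, (∑ t : Fin T, (coordMul (e k) (e l) (g (past δ (t : ℕ) ω)) - μ k l)) ^ 2 ∂P ≤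
          T * C := fun k l =>
    exists_integral_sum_coordMul_sq_le hδ hi hid hg (hg4 0) ha (e k) (e l)
  choose CM hCM using hM
  have hMint : ∀ T : ℕ, ∀ k l, Integrable (fun ω => ((T : ℝ)⁻¹ * ∑ t : Fin T,
      (coordMul (e k) (e l) (g (past δ (t : ℕ) ω)) - μ k l)) ^ 2) P := fun T k l => by
    simp only [mul_pow]
    exact (hCM k l T).1.const_mul _
  have hW1 : IsBigOP P (fun T ω => √(∑ k, ∑ l, ((T : ℝ)⁻¹ * ∑ t : Fin T,
      (coordMul (e k) (e l) (g (past δ (t : ℕ) ω)) - μ k l)) ^ 2)) r := by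
    refine isBigOP_sqrt_of_integral_le (r' := fun T => 1 / (T : ℝ)) (C := ∑ k, ∑ l, CM k l)
      (fun T ω => Finset.sum_nonneg fun k _ => Finset.sum_nonneg fun l _ => sq_nonneg _)
      (fun T => integrable_finsetSum _ fun k _ => integrable_finsetSum _ fun l _ => hMint T k l)
      hr0 (hpos.mono fun T hT => ⟨one_div_pos.2 hT.1, ?_⟩) (hpos.mono fun T hT => ?_)
    · have : 0 ≤ 1 / (p T : ℝ) := by positivity
      linarith [hrsq T]
    · rw [integral_finsetSum _ fun k _ => integrable_finsetSum _ fun l _ => hMint T k l,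
        Finset.sum_mul]
      refine Finset.sum_le_sum fun k _ => ?_
      rw [integral_finsetSum _ fun l _ => hMint T k l, Finset.sum_mul]
      refine Finset.sum_le_sum fun l _ => ?_
      simp only [mul_pow]
      rw [integral_const_mul]
      have hT0 : (T : ℝ) ≠ 0 := hT.1.ne'
      calc _ ≤ ((T : ℝ)⁻¹) ^ 2 * (T * CM k l) := by gcongr; exact (hCM k l T).2
        _ = _ := by field_simp
  obtain ⟨C, η, hC0, hη, hC⟩ := hSignal.increment_le hInc
  have hD : ∀ᶠ T in atTop, ∀ t : Fin T,
      Integrable (fun ω => ‖stepL2 (fun i => X t (s T i) ω) - g (past δ (t : ℕ) ω)‖ ^ 2) P ∧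
      ∫ ω, ‖stepL2 (fun i => X t (s T i) ω) - g (past δ (t : ℕ) ω)‖ ^ 2 ∂P ≤ C * (3 / p T) := by
    have h3 : ∀ᶠ T in atTop, 3 / (p T : ℝ) ≤ η := by
      have : Tendsto (fun T => 3 / (p T : ℝ)) atTop (𝓝 0) :=
        (tendsto_natCast_atTop_atTop.comp hp).const_div_atTop 3
      exact this.eventually_le_const hη
    filter_upwards [hev, h3] with T h1 h2 t
    exact hSignal.integral_norm_stepL2_sub_le (hXg t) (hgm t) hC0 (hC t) h1.2 h2 (hs T)
  have hZ2 : ∀ t : ℕ, Integrable (fun ω => ‖g (past δ t ω)‖ ^ 2) P := fun t =>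
    (((hg4 t).mono_exponent (by norm_num : (2 : ENNReal) ≤ 4)).norm).integrable_sq
  set CZ := ∫ ω, ‖g (past δ 0 ω)‖ ^ 2 ∂P with hCZ
  have hCZ0 : 0 ≤ CZ := integral_nonneg fun ω => sq_nonneg _
  have hZe : ∀ t : ℕ, ∫ ω, ‖g (past δ t ω)‖ ^ 2 ∂P = CZ := fun t =>
    ((identDistrib_past hδ hi hid t).comp
      (u := fun x => ‖g x‖ ^ 2) (hg.norm.measurable.pow_const 2)).integral_eq
  have hDint : ∀ᶠ T in atTop, ∀ t : Fin T, Integrable (fun ω => (√(p T : ℝ))⁻¹ *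
      ‖g (past δ (t : ℕ) ω)‖ ^ 2 + (√(p T : ℝ) + 1) *
        ‖stepL2 (fun i => X t (s T i) ω) - g (past δ (t : ℕ) ω)‖ ^ 2) P := by
    filter_upwards [hD] with T hT t
    exact ((hZ2 t).const_mul _).add ((hT t).1.const_mul _)
  have hW2 : IsBigOP P (fun T ω => (T : ℝ)⁻¹ * ∑ t : Fin T, ((√(p T : ℝ))⁻¹ *
      ‖g (past δ (t : ℕ) ω)‖ ^ 2 + (√(p T : ℝ) + 1) *
        ‖stepL2 (fun i => X t (s T i) ω) - g (past δ (t : ℕ) ω)‖ ^ 2)) r := by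
    refine IsBigOP.mono_rate (r := fun T => 1 / √(p T : ℝ)) ?_ (.of_forall fun T => ⟨by positivity, ?_⟩)
    -- The 6 comes from √p + 1 ≤ 2√p times the mean-square discretisation error 3C/p.
    · refine isBigOP_of_integral_le (C := CZ + 6 * C) (.of_forall fun T ω => by positivity)
        (hDint.mono fun T hT => (integrable_finsetSum _ fun t _ => hT t).const_mul _)
        (hpos.mono fun T hT => one_div_pos.2 (Real.sqrt_pos.2 hT.2)) ?_
      filter_upwards [hDint, hD, hpos, hev] with T h1 h2 h3 h4
      rw [integral_const_mul, integral_finsetSum _ fun t _ => h1 t]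
      have hT0 := h3.1
      have hq1 : 1 ≤ √(p T : ℝ) := by
        rw [Real.one_le_sqrt]
        exact_mod_cast (show 1 ≤ p T by omega)
      have hq : (p T : ℝ) = √(p T : ℝ) * √(p T : ℝ) := (Real.mul_self_sqrt h3.2.le).symm
      have hstep : ∀ t : Fin T, ∫ ω, ((√(p T : ℝ))⁻¹ *
          ‖g (past δ (t : ℕ) ω)‖ ^ 2 + (√(p T : ℝ) + 1) *
          ‖stepL2 (fun i => X t (s T i) ω) - g (past δ (t : ℕ) ω)‖ ^ 2) ∂P ≤
          (CZ + 6 * C) * (1 / √(p T : ℝ)) := fun t => by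
        rw [integral_add ((hZ2 t).const_mul _) ((h2 t).1.const_mul _), integral_const_mul,
          integral_const_mul, hZe]
        calc _ ≤ (√(p T : ℝ))⁻¹ * CZ + (√(p T : ℝ) + √(p T : ℝ)) * (C * (3 / p T)) := by
              gcongr
              exact (h2 t).2
          _ = _ := by
              rw [hq]
              set q := √(p T : ℝ)
              rw [Real.sqrt_mul_self (by positivity)]
              field_simp
              ring
      calc _ ≤ (T : ℝ)⁻¹ * ∑ _t : Fin T, (CZ + 6 * C) * (1 / √(p T : ℝ)) := by
            gcongr with t
            exact hstep t
        _ = _ := by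
            rw [Finset.sum_const, Finset.card_univ, Fintype.card_fin, nsmul_eq_mul]
            field_simp
    · have : 0 ≤ 1 / √(T : ℝ) := by positivity
      simp only [hr]
      linarith
  obtain ⟨hCint, CC, hCC⟩ := integral_crossMatrix_le hNoise hSignal s
  obtain ⟨CN, hCN⟩ := hNoise.integral_noiseMatrix_le
  have hW3 : IsBigOP P (fun T ω => √(∑ i, ∑ j, crossMatrix X s u T ω i j ^ 2)) r := by
    refine isBigOP_sqrt_of_integral_le (r' := fun T => 1 / (T : ℝ)) (C := CC)
      (fun T ω => Finset.sum_nonneg fun k _ => Finset.sum_nonneg fun l _ => sq_nonneg _)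
      hCint hr0 (hpos.mono fun T hT => ⟨one_div_pos.2 hT.1, ?_⟩)
      (hev.mono fun T hT => hCC T hT.1 (by omega))
    have : 0 ≤ 1 / (p T : ℝ) := by positivity
    linarith [hrsq T]
  have hW4 : IsBigOP P (fun T ω => √(∑ i, ∑ j, noiseMatrix u T ω i j ^ 2)) r :=
    isBigOP_sqrt_of_integral_le (r' := fun T => 1 / (p T : ℝ) + 1 / (T : ℝ)) (C := CN)
      (fun T ω => Finset.sum_nonneg fun k _ => Finset.sum_nonneg fun l _ => sq_nonneg _)
      hNoise.integrable_noiseMatrix hr0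
      (hpos.mono fun T hT => ⟨add_pos (one_div_pos.2 hT.2) (one_div_pos.2 hT.1), hrsq T⟩)
      (hev.mono fun T hT => hCN T hT.1 (by omega))
  -- The cross term appears twice in the expanded square, hence the repeated `hW3`.
  refine ⟨_, ((hW1.add hW2).add (hW3.add hW3)).add hW4, ?_⟩
  filter_upwards [hev] with T hT
  filter_upwards [ae_all_iff.2 hgV] with ω hω i
  refine hSignal.abs_sub_gammaHat_le hEig (hXg 0) (hg4 0) (hgV 0) (by omega) _ (fun f => ?_) i
  exact abs_sum_inner_sq_sub_le hT.1 (by omega) (fun t : Fin T => g (past δ (t : ℕ) ω))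
    (fun t i => X t (s T i) ω) (fun t i => u T t i ω) he (fun t => hω t) μ f

end Main

end NoisyFDA

/-! ### Uniform rate and convergence of the reciprocal. -/

theorem mainTheorem4 {Ω : Type*} [MeasurableSpace Ω] (P : Measure Ω) [IsProbabilityMeasure P]
    {S : Type*} [MeasurableSpace S]
    (X : ℕ → I → Ω → ℝ) (p : ℕ → ℕ) (s : (T : ℕ) → Fin (p T) → I)
    (u : (T : ℕ) → Fin T → Fin (p T) → Ω → ℝ) (γ : ℤ → ℝ)
    (L : ℕ) (hL : 1 ≤ L) (lam : ℕ → ℝ) (φ : ℕ → I → ℝ)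
    (hNoise : NoisyFDA.NoiseAssumption P X p u γ)
    (hSignal : NoisyFDA.SignalAssumption S P X L)
    (hEig : NoisyFDA.IsEigensystem (fun r v => cov[X 0 r, X 0 v; P]) lam φ)
    (hPhi : NoisyFDA.EigenfunctionAssumption p s φ L)
    (hp : NoisyFDA.DivergesSubexponentially p)
    (hs : ∀ T, NoisyFDA.IsEquidistant (s T))
    (hInc : NoisyFDA.IncrementCondition P (X 0)) :
    NoisyFDA.IsBigOP P
      (fun T ω => ⨆ i : ℕ, |lam i - NoisyFDA.gammaHat (NoisyFDA.dataMatrix X p s u T ω) i / p T|)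
      (fun T => 1 / √(p T) + 1 / √T) ∧
    (0 < lam (L - 1) →
      TendstoInMeasure P
        (fun T ω => (p T : ℝ) / NoisyFDA.gammaHat (NoisyFDA.dataMatrix X p s u T ω) (L - 1))
        atTop (fun _ => 1 / lam (L - 1)) ∧
      NoisyFDA.IsBigOP P
        (fun T ω => (p T : ℝ) / NoisyFDA.gammaHat (NoisyFDA.dataMatrix X p s u T ω) (L - 1))
        (fun _ => 1)) := by
  obtain ⟨W, hW, hbound⟩ :=
    NoisyFDA.exists_isBigOP_bound hL hNoise hSignal hEig hp.1 hs hInc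
  refine ⟨hW.mono_ae ?_, fun hlam => ?_⟩
  · filter_upwards [hbound] with T hT
    filter_upwards [hT] with ω hω
    rw [abs_of_nonneg (Real.iSup_nonneg fun i => abs_nonneg _)]
    -- One W bounds all indices outside a single null set, so the supremum inherits the bound.
    exact (ciSup_le hω).trans (le_abs_self _)
  · have hr : Tendsto (fun T : ℕ => 1 / √(p T : ℝ) + 1 / √(T : ℝ)) atTop (𝓝 0) := by
      have h1 : Tendsto (fun T : ℕ => 1 / √(p T : ℝ)) atTop (𝓝 0) :=
        (Real.tendsto_sqrt_atTop.comp
          (tendsto_natCast_atTop_atTop.comp hp.1)).const_div_atTop 1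
      have h2 : Tendsto (fun T : ℕ => 1 / √(T : ℝ)) atTop (𝓝 0) :=
        (Real.tendsto_sqrt_atTop.comp tendsto_natCast_atTop_atTop).const_div_atTop 1
      simpa using h1.add h2
    have h1 : NoisyFDA.IsBigOP P (fun T ω => lam (L - 1) -
        NoisyFDA.gammaHat (NoisyFDA.dataMatrix X p s u T ω) (L - 1) / p T)
        (fun T => 1 / √(p T) + 1 / √T) := by
      refine hW.mono_ae ?_
      filter_upwards [hbound] with T hT
      filter_upwards [hT] with ω hω
      exact (hω _).trans (le_abs_self _)
    have h2 := h1.tendstoInMeasure_inv hlam.ne' hr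
    simp only [inv_div] at h2
    rw [← one_div] at h2
    exact ⟨h2, NoisyFDA.isBigOP_one_of_tendstoInMeasure h2⟩
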